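/- Let $n\ge 3$. For $2\le m\le n$ let $\mathcal Y_m=\{y_{m1},\dots,y_{mm}\}$, let $L$ be the free Lie algebra over $\mathbb Z$ on the disjoint union $\mathcal Y_2\cup\dots\cup\mathcal Y_n$, and let $L^m$ be its homogeneous component of degree $m$. Let $L(Y_i)$ be the Lie subalgebra of $L$ generated by $\mathcal Y_i$ (it is free on $\mathcal Y_i$) and $L^m(Y_i)$ its homogeneous component of degree $m$. Commutators are left-normed. Let $J$ be the ideal of $L$ generated by all elements (1) $[y_{mi},y_{ri}]$ with $2\le r<m\le n$, $1\le i\le r$; (2) $[y_{mi},y_{rj}]$ with $2\le r<i\le m\le n$, $1\le j\le r$; (3) $[y_{mi},y_{rj}]-[y_{mi},y_{mj}]$ with $2\le r<m\le n$, $1\le i,j\le r$, $i\ne j$; and put $J^m=J\cap L^m$. For submodules $A,B$ of $L$ let $[A,B]$ be the $\mathbb Z$-span of all $[a,b]$, $a\in A$, $b\in B$; let $[A,{}_kB]=[A,B,\dots,B]$ with $k$ entries $B$, and $B\wr A=\sum_{k\ge0}[B,{}_kA]$. For $2\le r\le n-1$ let $Y_r$ be the $\mathbb Z$-span of $\mathcal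 Y_r$, let $U_{r+1}$ be the $\mathbb Z$-span of $\mathcal U_{r+1}=\mathcal Y_{r+1}\cup\dots\cup\mathcal Y_n$, let $L(U_{r+1}\wr Y_r)$ be the Lie subalgebra of $L$ generated by $U_{r+1}\wr Y_r$, and let $W_{(r)}=\sum_{a,b\ge0}[U_{r+1},Y_r,{}_aY_r,{}_bU_{r+1}]\subseteq L(U_{r+1}\wr Y_r)$. For $r<m\le n$, $1\le i\le m$, $1\le j\le r$ let $\psi_{2,r}([y_{mi},y_{rj}])$ be $[y_{mi},y_{rj}]-[y_{mi},y_{mj}]$ if $i\le r$ and $j\neq i$, and $[y_{mi},y_{rj}]$ otherwise. Then: (a) $L=\left(\bigoplus_{i=2}^nL(Y_i)\right)\oplus J$ as $\mathbb Z$-modules, and $J=\bigoplus_{m\ge2}J^m$. (b) For each $r\in\{2,\dots,n-1\}$ there is exactly one Lie algebra automorphism $\Psi_r$ of $L(U_{r+1}\wr Y_r)$ with $\Psi_r(u)=u$ and $\Psi_r([u,z,z_1,\dots,z_k])=[\psi_{2,r}([u,z]),z_1,\dots,z_k]$ for all $u\in\mathcal U_{r+1}$, $k\ge0$ and $z,z_1,\dots,z_k\in\mathcal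 Y_r$. (c) Let $L(\Psi_r(W_{(r)}))$ be the Lie subalgebra of $L$ generated by $\Psi_r(W_{(r)})$ and let $L^m_{\rm grad}(\Psi_r(W_{(r)}))=L^m\cap L(\Psi_r(W_{(r)}))$. Then, for every $m\ge2$, $$L^m=\Big(\bigoplus_{i=2}^nL^m(Y_i)\Big)\oplus\Big(\bigoplus_{j=2}^{n-1}L^m_{\rm grad}(\Psi_j(W_{(j)}))\Big)\quad\text{and}\quad J^m=\bigoplus_{j=2}^{n-1}L^m_{\rm grad}(\Psi_j(W_{(j)})).$$ All direct sums are internal direct sums of $\mathbb Z$-submodules of $L$. -/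

import Mathlib

namespace PartialInner

section Generic

variable {𝔤 : Type*} [LieRing 𝔤]

/-- The left-normed commutator `[x, z₁, …, zₖ] = [… [[x, z₁], z₂], …, zₖ]`. -/
def leftNormed (x : 𝔤) (l : List 𝔤) : 𝔤 :=
  l.foldl (fun a b => ⁅a, b⁆) x

/-- `IsLieMonomial S m x`: `x` is a Lie commutator, with some bracketing, of `m` elements
of `S`. -/
inductive IsLieMonomial (S : Set 𝔤) : ℕ → 𝔤 → Prop
  | of_mem {x : 𝔤} : x ∈ S → IsLieMonomial S 1 x
  | lie {p q : ℕ} {x z : 𝔤} :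
      IsLieMonomial S p x → IsLieMonomial S q z → IsLieMonomial S (p + q) ⁅x, z⁆

/-- The `ℤ`-module spanned by the Lie commutators of `m` elements of `S`. If `S` is part of a free
generating set of a free Lie algebra, this is the homogeneous component of degree `m` of the
free Lie algebra `L(S)`. -/
def homogeneous (S : Set 𝔤) (m : ℕ) : Submodule ℤ 𝔤 :=
  Submodule.span ℤ {x | IsLieMonomial S m x}

/-- For submodules `A`, `B` of a Lie algebra, `[A, B]` is the submodule spanned by
all `[a, b]` with `a ∈ A` and `b ∈ B`. -/
def lieProd (A B : Submodule ℤ 𝔤) : Submodule ℤ 𝔤 :=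
  Submodule.span ℤ (Set.image2 (fun a b => ⁅a, b⁆) (A : Set 𝔤) (B : Set 𝔤))

/-- `[A, B, …, B]` with `k` entries `B`. -/
def lieProdIter (A B : Submodule ℤ 𝔤) : ℕ → Submodule ℤ 𝔤
  | 0 => A
  | k + 1 => lieProd (lieProdIter A B k) B

/-- `B ≀ A = B + [B, A] + [B, A, A] + ⋯`. -/
def wreath (B A : Submodule ℤ 𝔤) : Submodule ℤ 𝔤 :=
  ⨆ k : ℕ, lieProdIter B A k

/-- `M` is the (internal) direct sum of its submodules `A i`. -/
def IsDirectSum {ι : Type*} (A : ι → Submodule ℤ 𝔤) (M : Submodule ℤ 𝔤) : Prop :=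
  iSupIndep A ∧ ⨆ i, A i = M

theorem leftNormed_mem_lieProdIter (A B : Submodule ℤ 𝔤) (zs : List 𝔤) (hz : ∀ z ∈ zs, z ∈ B) :
    ∀ (k : ℕ) (x : 𝔤), x ∈ lieProdIter A B k →
      leftNormed x zs ∈ lieProdIter A B (k + zs.length) := by
  induction zs with
  | nil => intro k x hx; exact hx
  | cons z zs ih =>
    intro k x hx
    have h1 : ⁅x, z⁆ ∈ lieProdIter A B (k + 1) :=
      Submodule.subset_span ⟨x, hx, z, hz z (by simp), rfl⟩
    have h2 := ih (fun w hw => hz w (by simp [hw])) (k + 1) _ h1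
    have e : k + (z :: zs).length = k + 1 + zs.length := by
      simp only [List.length_cons]; omega
    rw [e]
    exact h2

end Generic

/-- The index set of the generators `y_{mi}`, `2 ≤ m ≤ n`, `1 ≤ i ≤ m`;
here `m` is `row` and `i` is `col`. -/
@[ext]
structure Gen (n : ℕ) where
  row : ℕ
  col : ℕ
  two_le_row : 2 ≤ row
  row_le : row ≤ n
  one_le_col : 1 ≤ col
  col_le : col ≤ row

/-- The free Lie algebra over `ℤ` on `𝒴 = 𝒴₂ ∪ ⋯ ∪ 𝒴ₙ`. -/
abbrev L (n : ℕ) : Type := FreeLieAlgebra ℤ (Gen n)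

noncomputable section

variable {n : ℕ}

/-- The free generators of `L n`. -/
def y (a : Gen n) : L n := FreeLieAlgebra.of ℤ a

/-- `y_{mj}`, where `a = (m, i)`, `b = (r, j)` and `r < m`. -/
def mixed (a b : Gen n) (h : b.row < a.row) : Gen n :=
  ⟨a.row, b.col, a.two_le_row, a.row_le, b.one_le_col, b.col_le.trans h.le⟩

/-- `ψ_{2,r}([y_{mi}, y_{rj}])` for `r < m`, as a function of `a = (m, i)` and `b = (r, j)`:
`[y_{mi}, y_{rj}] - [y_{mi}, y_{mj}]` if `i ≤ r` and `j ≠ i`, and `[y_{mi}, y_{rj}]` otherwise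
(that is, if `i = j` or `r < i`). -/
def psi2 (a b : Gen n) (h : b.row < a.row) : L n :=
  if a.col ≤ b.row ∧ b.col ≠ a.col then ⁅y a, y b⁆ - ⁅y a, y (mixed a b h)⁆ else ⁅y a, y b⁆

variable (n)

/-- `𝒴_i = {y_{i1}, …, y_{ii}}`. -/
def rowSet (i : ℕ) : Set (L n) := {x | ∃ a : Gen n, a.row = i ∧ x = y a}

/-- `𝒰_r = 𝒴_r ∪ ⋯ ∪ 𝒴_n`. -/
def upperSet (r : ℕ) : Set (L n) := {x | ∃ a : Gen n, r ≤ a.row ∧ x = y a}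

/-- The module `Y_i`. -/
def Y (i : ℕ) : Submodule ℤ (L n) := Submodule.span ℤ (rowSet n i)

/-- The module `U_r = Y_r ⊕ ⋯ ⊕ Y_n`. -/
def U (r : ℕ) : Submodule ℤ (L n) := Submodule.span ℤ (upperSet n r)

/-- `L(Y_i)`, the Lie subalgebra of `L` (freely) generated by `𝒴_i`. -/
def LY (i : ℕ) : LieSubalgebra ℤ (L n) := LieSubalgebra.lieSpan ℤ (L n) (rowSet n i)

/-- `L^m`, the homogeneous component of degree `m` of `L`. -/
def Ldeg (m : ℕ) : Submodule ℤ (L n) := homogeneous (Set.range (y (n := n))) m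

/-- `L^m(Y_i)`, the homogeneous component of degree `m` of `L(Y_i)`. -/
def LYdeg (i m : ℕ) : Submodule ℤ (L n) := homogeneous (rowSet n i) m

/-- The three families of relators. -/
def relators : Set (L n) :=
  {x | ∃ a b : Gen n, b.row < a.row ∧ a.col = b.col ∧ x = ⁅y a, y b⁆} ∪
  {x | ∃ a b : Gen n, b.row < a.col ∧ x = ⁅y a, y b⁆} ∪
  {x | ∃ (a b : Gen n) (h : b.row < a.row), a.col ≤ b.row ∧ b.col ≠ a.col ∧
    x = ⁅y a, y b⁆ - ⁅y a, y (mixed a b h)⁆}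

/-- The ideal `J` of `L` generated by the relators. -/
def J : LieIdeal ℤ (L n) := LieSubmodule.lieSpan ℤ (L n) (relators n)

/-- `J^m = J ∩ L^m`. -/
def Jdeg (m : ℕ) : Submodule ℤ (L n) := (J n).toSubmodule ⊓ Ldeg n m

/-- `L(U_{r+1} ≀ Y_r)`, the Lie subalgebra of `L` (freely) generated by `U_{r+1} ≀ Y_r`. -/
def LWreath (r : ℕ) : LieSubalgebra ℤ (L n) :=
  LieSubalgebra.lieSpan ℤ (L n) (wreath (U n (r + 1)) (Y n r) : Set (L n))

/-- `W_{(r)}`, the sum over `a, b ≥ 0` of the modules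
`[U_{r+1}, Y_r, Y_r, …, Y_r, U_{r+1}, …, U_{r+1}]`, where after the first two entries there are
`a` entries `Y_r` and then `b` entries `U_{r+1}`. -/
def W (r : ℕ) : Submodule ℤ (L n) :=
  ⨆ (a : ℕ) (b : ℕ),
    lieProdIter (lieProdIter (lieProd (U n (r + 1)) (Y n r)) (Y n r) a) (U n (r + 1)) b

theorem leftNormed_mem_LWreath (r : ℕ) (a : Gen n) (ha : r < a.row) (zs : List (Gen n))
    (hz : ∀ z ∈ zs, z.row = r) : leftNormed (y a) (zs.map y) ∈ LWreath n r := by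
  refine LieSubalgebra.subset_lieSpan ?_
  refine Submodule.mem_iSup_of_mem (0 + (zs.map (y (n := n))).length)
    (leftNormed_mem_lieProdIter _ _ _ ?_ 0 _ (Submodule.subset_span ⟨a, ha, rfl⟩))
  intro z h
  obtain ⟨c, hc, rfl⟩ := List.mem_map.1 h
  exact Submodule.subset_span ⟨c, hz c hc, rfl⟩

/-- The automorphism `Ψ` of `L(U_{r+1} ≀ Y_r)` takes the prescribed values on the
basis `𝒰_{r+1} ∪ ⋃_{k ≥ 1} [𝒰_{r+1}, 𝒴_r, …, 𝒴_r]` (`k` entries `𝒴_r`) of `U_{r+1} ≀ Y_r`: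
`Ψ(u) = u` and `Ψ([u, z, z₁, …, zₖ]) = [ψ_{2,r}([u, z]), z₁, …, zₖ]`, for `u ∈ 𝒰_{r+1}`
and `z, z₁, …, zₖ ∈ 𝒴_r`, `k ≥ 0`. -/
def IsPsi (r : ℕ) (Ψ : LWreath n r ≃ₗ⁅ℤ⁆ LWreath n r) : Prop :=
  (∀ (u : Gen n) (hu : r < u.row),
    (Ψ ⟨y u, leftNormed_mem_LWreath n r u hu [] (by simp)⟩ : L n) = y u) ∧
  (∀ (u z : Gen n) (hu : r < u.row) (hz : z.row = r) (zs : List (Gen n))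
    (hzs : ∀ w ∈ zs, w.row = r),
    (Ψ ⟨leftNormed ⁅y u, y z⁆ (zs.map y), leftNormed_mem_LWreath n r u hu (z :: zs)
      (List.forall_mem_cons.2 ⟨hz, hzs⟩)⟩ : L n) =
      leftNormed (psi2 u z (hz.trans_lt hu)) (zs.map y))

variable {n}

/-- `L(Ψ(W_{(r)}))`, the Lie subalgebra (freely) generated by the
module `Ψ(W_{(r)}) ⊆ L(U_{r+1} ≀ Y_r)`. -/
def LPsiW (r : ℕ) (Ψ : LWreath n r ≃ₗ⁅ℤ⁆ LWreath n r) : LieSubalgebra ℤ (L n) :=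
  LieSubalgebra.lieSpan ℤ (L n) {x | ∃ w : LWreath n r, (w : L n) ∈ W n r ∧ (Ψ w : L n) = x}

/-- `L^m_grad(Ψ(W_{(r)})) = L^m ∩ L(Ψ(W_{(r)}))`. -/
def Lgrad (r : ℕ) (Ψ : LWreath n r ≃ₗ⁅ℤ⁆ LWreath n r) (m : ℕ) : Submodule ℤ (L n) :=
  Ldeg n m ⊓ (LPsiW r Ψ).toSubmodule

end

end PartialInner

/-!
The quotient `L / J` is an iterated semidirect product of the free Lie algebras `L(Y_i)`: modulo
`J`, a generator `y_{sj}` of a lower row acts on the higher rows `m > s` as the partial inner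
derivation `y_{mi} ↦ [y_{mi}, y_{mj}]` for `i ≤ s`, and `y_{mi} ↦ 0` for `i > s`. All relators have
the single shape `ψ([y_{mi}, y_{sj}])` (`relators_eq`), and the partial inner derivations satisfy
the relations which `J` imposes on the lower rows (`lie_rowDer`). Hence for `r ≤ t` there is a
homomorphism `rowAction n r t` from `L` to `L ⋊ Der L` which keeps the rows between `r` and `t`,
kills those above `t`, and lets the rows up to `r` act by derivations.

All independence statements come from the `L`-components `rowProj n r t` of these homomorphisms.
For `t = r + 1` the homomorphism kills `J`, and `rowProj` is the identity on `L(Y_{r+1})` and zero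
on the other `L(Y_i)`; subtracting these projections from the identity gives the projection
`idealProj` onto `J`. For `t = n` it kills `L(Ψ_s(W_{(s)}))` for `s ≤ r`, while `rowProj` is the
identity on the subalgebra generated by the rows above `r`, so that the difference of two
consecutive projections singles out one of the `L(Ψ_s(W_{(s)}))`.

For the spanning statements, write `L(U_r)` for the subalgebra generated by the rows from `r` on.
Then `L(U_r) = L(Y_r) + L(U_{r+1} ≀ Y_r)` and `L(U_{r+1} ≀ Y_r) = L(U_{r+1}) + L(W_{(r)})`, because
in both cases the generators of the first summand normalise the second (`lieSpan_union_le_sup`).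
Applying `Ψ_r`, which fixes `L(U_{r+1})`, turns the last summand into `L(Ψ_r(W_{(r)}))`
(`IsPsi.LU_le`), and it lies in `J` since `Ψ_r([u, z, …]) = [ψ([u, z]), …]`. Descending from
`L(U_2) = L` exhausts `L`.

The automorphism `Ψ_r` exists because `L(U_{r+1} ≀ Y_r)` is free on the left-normed commutators
`[u, z₁, …, zₖ]` (`wreathEquiv`). This is Lazard elimination: the evaluation map from the free Lie
algebra on symbols for these commutators has a left inverse, obtained by letting the row `r` act on
the symbols by derivations. In terms of the symbols, `Ψ_r` changes a generator by an element of the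
subalgebra on the shorter symbols, and such triangular endomorphisms are bijective
(`perturb_bijective`).

The graded statements follow since all the subalgebras involved are generated by homogeneous
elements, and `degreeProj` projects onto a single degree.
-/

/-! ### Derivations and triangular endomorphisms of a free Lie ring -/

namespace PartialInner

section FreeLie

variable {X : Type*} {𝔤 : Type*} [LieRing 𝔤]

/-- The universal property of the free Lie algebra over `ℤ`, stated for the `ℤ`-structure which
every Lie ring carries. -/
noncomputable def freeLift [LieAlgebra ℤ 𝔤] (f : X → 𝔤) : FreeLieAlgebra ℤ X →ₗ⁅ℤ⁆ 𝔤 where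
  toFun := FreeLieAlgebra.lift ℤ f
  map_add' := map_add _
  map_smul' k x := by
    exact (map_zsmul (FreeLieAlgebra.lift ℤ f) k x).trans (int_smul_eq_zsmul _ k _).symm
  map_lie' := LieHom.map_lie _ _ _

@[simp]
theorem freeLift_of [LieAlgebra ℤ 𝔤] (f : X → 𝔤) (x : X) :
    freeLift f (FreeLieAlgebra.of ℤ x) = f x :=
  FreeLieAlgebra.lift_of_apply f x

theorem lieSpan_range_of :
    LieSubalgebra.lieSpan ℤ (FreeLieAlgebra ℤ X) (Set.range (FreeLieAlgebra.of ℤ)) = ⊤ := by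
  set S := LieSubalgebra.lieSpan ℤ (FreeLieAlgebra ℤ X) (Set.range (FreeLieAlgebra.of ℤ))
  -- the hom onto `S` given by the universal property splits the inclusion of `S`
  let g : FreeLieAlgebra ℤ X →ₗ⁅ℤ⁆ S :=
    freeLift fun x => ⟨FreeLieAlgebra.of ℤ x, LieSubalgebra.subset_lieSpan ⟨x, rfl⟩⟩
  have key : ∀ x, (g x : FreeLieAlgebra ℤ X) = x := by
    intro x
    let G : @LieHom ℤ (FreeLieAlgebra ℤ X) (FreeLieAlgebra ℤ X) _ _
        (FreeLieAlgebra.instLieAlgebra ℤ X) _ (FreeLieAlgebra.instLieAlgebra ℤ X) :=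
      { toFun := fun x => (g x : FreeLieAlgebra ℤ X)
        map_add' := fun a b => by simp
        map_smul' := fun k a => by
          exact congrArg Subtype.val (g.map_smul k a)
        map_lie' := fun {a b} => by simp }
    have : G = LieHom.id := by
      apply FreeLieAlgebra.hom_ext
      intro x
      change ((g (FreeLieAlgebra.of ℤ x) : S) : FreeLieAlgebra ℤ X) = FreeLieAlgebra.of ℤ x
      simp [g]
    exact congrArg (fun F => F x) this
  rw [eq_top_iff]
  intro x _
  rw [← key x]
  exact (g x).2

theorem freeLie_induction {p : FreeLieAlgebra ℤ X → Prop}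
    (of : ∀ x, p (FreeLieAlgebra.of ℤ x)) (zero : p 0) (add : ∀ a b, p a → p b → p (a + b))
    (smul : ∀ (k : ℤ) a, p a → p (k • a)) (lie : ∀ a b, p a → p b → p ⁅a, b⁆)
    (a : FreeLieAlgebra ℤ X) : p a := by
  have ha : a ∈ LieSubalgebra.lieSpan ℤ (FreeLieAlgebra ℤ X)
      (Set.range (FreeLieAlgebra.of ℤ)) := by
    rw [lieSpan_range_of]; trivial
  induction ha using LieSubalgebra.lieSpan_induction with
  | mem x h => obtain ⟨x, rfl⟩ := h; exact of x
  | zero => exact zero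
  | add x y _ _ h1 h2 => exact add x y h1 h2
  | smul k x _ h => exact smul k x h
  | lie x y _ _ h1 h2 => exact lie x y h1 h2

theorem freeLie_hom_ext [LieAlgebra ℤ 𝔤] {f g : FreeLieAlgebra ℤ X →ₗ⁅ℤ⁆ 𝔤}
    (h : ∀ x, f (FreeLieAlgebra.of ℤ x) = g (FreeLieAlgebra.of ℤ x)) : f = g := by
  refine LieHom.ext fun a => ?_
  induction a using freeLie_induction with
  | of x => exact h x
  | zero => simp
  | add a b h1 h2 => simp [h1, h2]
  | smul k a h => rw [map_zsmul, map_zsmul, h]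
  | lie a b h1 h2 => simp [h1, h2]

/-- The Lie ring `𝔤 ⊗ ℤ[ε]/(ε²)`, with `(x, a)` standing for `x + ε a`. A Lie homomorphism
into it whose first component is the identity has a derivation as its second component. -/
def Tangent (𝔤 : Type*) := 𝔤 × 𝔤

instance : AddCommGroup (Tangent 𝔤) := inferInstanceAs (AddCommGroup (𝔤 × 𝔤))

instance : Bracket (Tangent 𝔤) (Tangent 𝔤) :=
  ⟨fun a b => (⁅a.1, b.1⁆, ⁅a.1, b.2⁆ + ⁅a.2, b.1⁆)⟩

/-- The element `x + ε a`. -/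
def Tangent.mk {M : Type*} (x a : M) : Tangent M := (x, a)

@[ext]
theorem Tangent.ext {M : Type*} {a b : Tangent M} (h₁ : a.1 = b.1) (h₂ : a.2 = b.2) : a = b :=
  Prod.ext h₁ h₂

theorem Tangent.fst_add (a b : Tangent 𝔤) : (a + b).1 = a.1 + b.1 := rfl

theorem Tangent.snd_add (a b : Tangent 𝔤) : (a + b).2 = a.2 + b.2 := rfl

theorem Tangent.fst_lie (a b : Tangent 𝔤) : ⁅a, b⁆.1 = ⁅a.1, b.1⁆ := rfl

theorem Tangent.snd_lie (a b : Tangent 𝔤) : ⁅a, b⁆.2 = ⁅a.1, b.2⁆ + ⁅a.2, b.1⁆ := rfl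

instance : LieRing (Tangent 𝔤) where
  add_lie a b c := by
    ext
    · simp only [Tangent.fst_lie, Tangent.fst_add, add_lie]
    · simp only [Tangent.snd_lie, Tangent.fst_add, Tangent.snd_add, add_lie]
      abel
  lie_add a b c := by
    ext
    · simp only [Tangent.fst_lie, Tangent.fst_add, lie_add]
    · simp only [Tangent.snd_lie, Tangent.fst_add, Tangent.snd_add, lie_add]
      abel
  lie_self a := by
    ext
    · exact lie_self a.1
    · rw [Tangent.snd_lie, ← lie_skew a.1 a.2, neg_add_cancel]; rfl
  leibniz_lie a b c := by
    ext
    · exact leibniz_lie _ _ _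
    · simp only [Tangent.snd_lie, Tangent.fst_lie, Tangent.snd_add, lie_add, add_lie]
      rw [leibniz_lie a.1 b.1 c.2, leibniz_lie a.1 b.2 c.1, leibniz_lie a.2 b.1 c.1]
      abel

/-- The homomorphism `x ↦ x + ε v x` into the tangent Lie ring. -/
noncomputable def toTangent (v : X → FreeLieAlgebra ℤ X) :
    FreeLieAlgebra ℤ X →ₗ⁅ℤ⁆ Tangent (FreeLieAlgebra ℤ X) :=
  freeLift fun x => Tangent.mk (FreeLieAlgebra.of ℤ x) (v x)

theorem toTangent_fst (v : X → FreeLieAlgebra ℤ X) (a : FreeLieAlgebra ℤ X) :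
    (toTangent v a).1 = a := by
  induction a using freeLie_induction with
  | of x => rw [toTangent, freeLift_of]; rfl
  | zero => rw [map_zero]; rfl
  | add a b h1 h2 => rw [map_add, Tangent.fst_add, h1, h2]
  | smul k a h =>
    rw [map_zsmul]
    exact congrArg (k • ·) h
  | lie a b h1 h2 => rw [LieHom.map_lie, Tangent.fst_lie, h1, h2]

/-- The derivation of the free Lie algebra with prescribed values on the free generators. -/
noncomputable def freeDer (v : X → FreeLieAlgebra ℤ X) :
    LieDerivation ℤ (FreeLieAlgebra ℤ X) (FreeLieAlgebra ℤ X) :=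
  { toFun := fun a => (toTangent v a).2
    map_add' := fun a b => by rw [map_add]; rfl
    map_smul' := fun k a => by rw [map_zsmul]; rfl
    leibniz' := fun a b => by
      change (toTangent v ⁅a, b⁆).2 = ⁅a, (toTangent v b).2⁆ - ⁅b, (toTangent v a).2⁆
      rw [LieHom.map_lie, Tangent.snd_lie, toTangent_fst, toTangent_fst, ← lie_skew b,
        sub_neg_eq_add] }

@[simp]
theorem freeDer_of (v : X → FreeLieAlgebra ℤ X) (x : X) :
    freeDer v (FreeLieAlgebra.of ℤ x) = v x := by
  change (toTangent v (FreeLieAlgebra.of ℤ x)).2 = v x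
  rw [toTangent, freeLift_of]; rfl

theorem freeDer_ext {D E : LieDerivation ℤ (FreeLieAlgebra ℤ X) (FreeLieAlgebra ℤ X)}
    (h : ∀ x, D (FreeLieAlgebra.of ℤ x) = E (FreeLieAlgebra.of ℤ x)) : D = E :=
  LieDerivation.ext_of_lieSpan_eq_top _ lieSpan_range_of (by rintro _ ⟨x, rfl⟩; exact h x)

/-- The subalgebra generated by the free generators of rank less than `k`. -/
noncomputable def rankLT (ρ : X → ℕ) (k : ℕ) : LieSubalgebra ℤ (FreeLieAlgebra ℤ X) :=
  LieSubalgebra.lieSpan ℤ _ (FreeLieAlgebra.of ℤ '' {x | ρ x < k})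

theorem rankLT_mono (ρ : X → ℕ) {k l : ℕ} (h : k ≤ l) : rankLT ρ k ≤ rankLT ρ l :=
  LieSubalgebra.lieSpan_mono (Set.image_mono fun _ hx => lt_of_lt_of_le hx h)

theorem of_mem_rankLT {ρ : X → ℕ} {k : ℕ} {x : X} (h : ρ x < k) :
    FreeLieAlgebra.of ℤ x ∈ rankLT ρ k :=
  LieSubalgebra.subset_lieSpan ⟨x, h, rfl⟩

/-- The endomorphism `x ↦ x + c x` of the free Lie algebra. -/
noncomputable def perturb (c : X → FreeLieAlgebra ℤ X) :
    FreeLieAlgebra ℤ X →ₗ⁅ℤ⁆ FreeLieAlgebra ℤ X :=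
  freeLift fun x => FreeLieAlgebra.of ℤ x + c x

theorem perturb_of (c : X → FreeLieAlgebra ℤ X) (x : X) :
    perturb c (FreeLieAlgebra.of ℤ x) = FreeLieAlgebra.of ℤ x + c x :=
  freeLift_of _ x

/-- Induction on the rank: `x` is the image of `x - d`, where `d` has lower rank and maps
to `c x`. -/
theorem rankLT_le_map_perturb {ρ : X → ℕ} {c : X → FreeLieAlgebra ℤ X}
    (hc : ∀ x, c x ∈ rankLT ρ (ρ x)) (k : ℕ) :
    rankLT ρ k ≤ (rankLT ρ k).map (perturb c) := by
  induction k with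
  | zero =>
    refine LieSubalgebra.lieSpan_le.2 ?_
    rintro _ ⟨x, hx, rfl⟩
    exact absurd hx (Nat.not_lt_zero _)
  | succ k ih =>
    refine LieSubalgebra.lieSpan_le.2 ?_
    rintro _ ⟨x, hx, rfl⟩
    have hx' : ρ x ≤ k := Nat.lt_succ_iff.1 hx
    obtain ⟨d, hd, hdc⟩ := (LieSubalgebra.mem_map _ _ _).1 (ih (rankLT_mono ρ hx' (hc x)))
    refine (LieSubalgebra.mem_map _ _ _).2 ⟨FreeLieAlgebra.of ℤ x - d,
      sub_mem (of_mem_rankLT hx) (rankLT_mono ρ k.le_succ hd), ?_⟩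
    rw [map_sub, hdc, perturb_of, add_sub_cancel_right]

/-- A perturbation of the generators by elements of lower rank has a right inverse of the
same triangular shape. -/
theorem exists_perturb_rightInverse {ρ : X → ℕ} {c : X → FreeLieAlgebra ℤ X}
    (hc : ∀ x, c x ∈ rankLT ρ (ρ x)) :
    ∃ d : X → FreeLieAlgebra ℤ X, (∀ x, d x ∈ rankLT ρ (ρ x)) ∧
      ∀ a, perturb c (perturb d a) = a := by
  have h : ∀ x, ∃ d ∈ rankLT ρ (ρ x), perturb c d = - c x := fun x =>
    (LieSubalgebra.mem_map _ _ _).1 (rankLT_le_map_perturb hc _ (neg_mem (hc x)))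
  choose d hd hdc using h
  refine ⟨d, hd, fun a => ?_⟩
  have : (perturb c).comp (perturb d) = LieHom.id := freeLie_hom_ext fun x => by
    rw [LieHom.comp_apply, perturb_of d, map_add, hdc, perturb_of, add_neg_cancel_right]
    rfl
  exact congrArg (fun f => f a) this

theorem perturb_bijective {ρ : X → ℕ} {c : X → FreeLieAlgebra ℤ X}
    (hc : ∀ x, c x ∈ rankLT ρ (ρ x)) : Function.Bijective (perturb c) := by
  obtain ⟨d, hd, hcd⟩ := exists_perturb_rightInverse hc
  obtain ⟨e, -, hde⟩ := exists_perturb_rightInverse hd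
  refine ⟨fun a b hab => ?_, fun a => ⟨_, hcd a⟩⟩
  -- the right inverse `d` of `c` is onto, hence a two-sided inverse
  have h : ∀ a, perturb d (perturb c a) = a := fun a => by
    rw [← hde a, hcd]
  rw [← h a, hab, h]

end FreeLie

/-! ### Sums of subalgebras and independence of submodules -/

section Subalgebras

variable {𝔤 : Type*} [LieRing 𝔤]

/-- A submodule which is normalised by `S` is normalised by the subalgebra generated by `S`. -/
theorem lie_mem_of_mem_lieSpan {S : Set 𝔤} {B : Submodule ℤ 𝔤}
    (h : ∀ s ∈ S, ∀ b ∈ B, ⁅b, s⁆ ∈ B) {x : 𝔤} (hx : x ∈ LieSubalgebra.lieSpan ℤ 𝔤 S) :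
    ∀ b ∈ B, ⁅b, x⁆ ∈ B := by
  induction hx using LieSubalgebra.lieSpan_induction with
  | mem x hx => exact h x hx
  | zero => intro b _; simp
  | add x y _ _ h1 h2 => intro b hb; rw [lie_add]; exact add_mem (h1 b hb) (h2 b hb)
  | smul k x _ h => intro b hb; rw [lie_smul]; exact B.smul_mem k (h b hb)
  | lie x y _ _ h1 h2 =>
    intro b hb
    rw [leibniz_lie, ← lie_skew x ⁅b, y⁆, ← sub_eq_add_neg]
    exact B.sub_mem (h2 _ (h1 b hb)) (h1 _ (h2 b hb))

/-- It suffices to check on generators that `ad s` preserves a subalgebra. -/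
theorem lieSpan_lie_mem {T : Set 𝔤} {s : 𝔤}
    (h : ∀ t ∈ T, ⁅t, s⁆ ∈ LieSubalgebra.lieSpan ℤ 𝔤 T) {b : 𝔤}
    (hb : b ∈ LieSubalgebra.lieSpan ℤ 𝔤 T) : ⁅b, s⁆ ∈ LieSubalgebra.lieSpan ℤ 𝔤 T := by
  induction hb using LieSubalgebra.lieSpan_induction with
  | mem x hx => exact h x hx
  | zero => simp
  | add x y _ _ h1 h2 => rw [add_lie]; exact add_mem h1 h2
  | smul k x _ h => rw [smul_lie]; exact LieSubalgebra.smul_mem _ k h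
  | lie x y hx hy h1 h2 =>
    rw [lie_lie]
    exact sub_mem (LieSubalgebra.lie_mem _ hx h2) (LieSubalgebra.lie_mem _ hy h1)

/-- If `S` normalises the subalgebra generated by `T`, then the subalgebra generated by `S ∪ T`
is the sum of those generated by `S` and by `T`. -/
theorem lieSpan_union_le_sup {S T : Set 𝔤}
    (h : ∀ s ∈ S, ∀ t ∈ T, ⁅t, s⁆ ∈ LieSubalgebra.lieSpan ℤ 𝔤 T) :
    (LieSubalgebra.lieSpan ℤ 𝔤 (S ∪ T)).toSubmodule ≤
      (LieSubalgebra.lieSpan ℤ 𝔤 S).toSubmodule ⊔ (LieSubalgebra.lieSpan ℤ 𝔤 T).toSubmodule := by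
  set A := LieSubalgebra.lieSpan ℤ 𝔤 S
  set B := LieSubalgebra.lieSpan ℤ 𝔤 T
  have hBA : ∀ a ∈ A, ∀ b ∈ B, ⁅b, a⁆ ∈ B := fun a ha b hb =>
    lie_mem_of_mem_lieSpan (B := B.toSubmodule)
      (fun s hs b hb => lieSpan_lie_mem (h s hs) hb) ha b hb
  let C : LieSubalgebra ℤ 𝔤 :=
    { A.toSubmodule ⊔ B.toSubmodule with
      lie_mem' := by
        intro x y hx hy
        obtain ⟨a, ha, b, hb, rfl⟩ := Submodule.mem_sup.1 hx
        obtain ⟨c, hc, d, hd, rfl⟩ := Submodule.mem_sup.1 hy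
        refine Submodule.mem_sup.2 ⟨⁅a, c⁆, A.lie_mem ha hc, ⁅b, c⁆ - ⁅d, a⁆ + ⁅b, d⁆,
          add_mem (sub_mem (hBA c hc b hb) (hBA a ha d hd)) (B.lie_mem hb hd), ?_⟩
        rw [add_lie, lie_add, lie_add, ← lie_skew a d]
        abel }
  have : LieSubalgebra.lieSpan ℤ 𝔤 (S ∪ T) ≤ C := by
    refine LieSubalgebra.lieSpan_le.2 (Set.union_subset ?_ ?_)
    · exact fun s hs => Submodule.mem_sup_left (LieSubalgebra.subset_lieSpan hs)
    · exact fun s hs => Submodule.mem_sup_right (LieSubalgebra.subset_lieSpan hs)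
  exact this

/-- Submodules are independent as soon as each of them is separated from the others by a
linear map. -/
theorem iSupIndep_of_maps {ι M N : Type*} [AddCommGroup M] [AddCommGroup N]
    (V : ι → Submodule ℤ M) (f : ι → M →ₗ[ℤ] N)
    (hinj : ∀ i, ∀ x ∈ V i, f i x = 0 → x = 0)
    (hker : ∀ i j, i ≠ j → ∀ x ∈ V j, f i x = 0) : iSupIndep V := by
  intro i
  rw [Submodule.disjoint_def]
  intro x hx hx'
  refine hinj i x hx ?_
  have : ⨆ j, ⨆ (_ : j ≠ i), V j ≤ LinearMap.ker (f i) :=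
    iSup₂_le fun j hj y hy => hker i j hj.symm y hy
  exact this hx'

end Subalgebras

/-! ### Elimination and the automorphism `Ψ` -/

section LeftNormed

variable {𝔤 𝔥 : Type*} [LieRing 𝔤] [LieRing 𝔥]

theorem leftNormed_concat (x : 𝔤) (l : List 𝔤) (z : 𝔤) :
    leftNormed x (l ++ [z]) = ⁅leftNormed x l, z⁆ := by
  simp [leftNormed]

theorem lieProd_span_le {S T : Set 𝔤} {N : Submodule ℤ 𝔤}
    (h : ∀ s ∈ S, ∀ t ∈ T, ⁅s, t⁆ ∈ N) :
    lieProd (Submodule.span ℤ S) (Submodule.span ℤ T) ≤ N := by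
  refine Submodule.span_le.2 ?_
  rintro _ ⟨a, ha, b, hb, rfl⟩
  induction ha, hb using Submodule.span_induction₂ with
  | mem_mem x y hx hy => exact h x hx y hy
  | zero_left y hy => simp
  | zero_right x hx => simp
  | add_left x y z _ _ _ h1 h2 => simp only [add_lie]; exact N.add_mem h1 h2
  | add_right x y z _ _ _ h1 h2 => simp only [lie_add]; exact N.add_mem h1 h2
  | smul_left k x y _ _ h => simp only [smul_lie]; exact N.smul_mem k h
  | smul_right k x y _ _ h => simp only [lie_smul]; exact N.smul_mem k h

theorem lieProdIter_span_le {κ : Type*} (S : Set 𝔤) (g : κ → 𝔤) (k : ℕ) :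
    lieProdIter (Submodule.span ℤ S) (Submodule.span ℤ (Set.range g)) k ≤
      Submodule.span ℤ {x | ∃ s ∈ S, ∃ l : List κ, x = leftNormed s (l.map g)} := by
  have mono : ∀ {A A' B : Submodule ℤ 𝔤}, A ≤ A' → lieProd A B ≤ lieProd A' B :=
    fun h => Submodule.span_mono (Set.image2_subset_right h)
  induction k with
  | zero => exact Submodule.span_mono fun s hs => ⟨s, hs, [], rfl⟩
  | succ k ih =>
    refine (mono ih).trans (lieProd_span_le ?_)
    rintro _ ⟨s, hs, l, rfl⟩ _ ⟨z, rfl⟩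
    refine Submodule.subset_span ⟨s, hs, l ++ [z], ?_⟩
    rw [List.map_append, List.map_singleton, leftNormed_concat]

end LeftNormed

section Elimination

variable {n : ℕ} (r : ℕ)

variable (n) in
/-- The indices of the generators in rows above `r`. -/
abbrev Up := {a : Gen n // r < a.row}

variable (n) in
/-- The indices of the generators in row `r`. -/
abbrev Row := {b : Gen n // b.row = r}

variable (n) in
/-- The free Lie algebra on symbols `(u, [z₁, …, zₖ])`, which stand for the left-normed
commutators `[u, z₁, …, zₖ]` with `u` above row `r` and the `zᵢ` in row `r`. -/
abbrev WreathFree := FreeLieAlgebra ℤ (Up n r × List (Row n r))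

variable {r}

theorem rowSet_eq_range : rowSet n r = Set.range fun b : Row n r => y b.1 := by
  ext x
  constructor
  · rintro ⟨a, h, rfl⟩; exact ⟨⟨a, h⟩, rfl⟩
  · rintro ⟨⟨a, h⟩, rfl⟩; exact ⟨a, h, rfl⟩

/-- The derivation `(u, l) ↦ (u, l ++ [z])`, which stands for the bracket with `z`. -/
noncomputable def appendDer (z : Row n r) :
    LieDerivation ℤ (WreathFree n r) (WreathFree n r) :=
  freeDer fun p => FreeLieAlgebra.of ℤ (p.1, p.2 ++ [z])

variable (n r) in
/-- The evaluation `(u, [z₁, …, zₖ]) ↦ [u, z₁, …, zₖ]`. -/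
noncomputable def wreathEval : WreathFree n r →ₗ⁅ℤ⁆ L n :=
  freeLift fun p => leftNormed (y p.1.1) (p.2.map fun z => y z.1)

theorem wreathEval_of (p : Up n r × List (Row n r)) :
    wreathEval n r (FreeLieAlgebra.of ℤ p) = leftNormed (y p.1.1) (p.2.map fun z => y z.1) :=
  freeLift_of _ p

theorem wreathEval_of_cons (u : Up n r) (z : Row n r) (l : List (Row n r)) :
    wreathEval n r (FreeLieAlgebra.of ℤ (u, z :: l)) =
      leftNormed ⁅y u.1, y z.1⁆ ((l.map Subtype.val).map y) :=
  (wreathEval_of _).trans (by rw [List.map_map]; rfl)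

theorem wreathEval_appendDer (z : Row n r) (f : WreathFree n r) :
    wreathEval n r (appendDer z f) = ⁅wreathEval n r f, y z.1⁆ := by
  induction f using freeLie_induction with
  | of p =>
    rw [appendDer, freeDer_of, wreathEval_of, wreathEval_of, List.map_append,
      List.map_singleton, leftNormed_concat]
  | zero => simp
  | add a b h1 h2 => simp only [map_add, h1, h2, add_lie]
  | smul k a h => simp only [map_zsmul, h, smul_lie]
  | lie a b h1 h2 =>
    rw [LieDerivation.apply_lie_eq_add, map_add, LieHom.map_lie, LieHom.map_lie, LieHom.map_lie,
      h1, h2, lie_lie (wreathEval n r a) (wreathEval n r b),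
      ← lie_skew ⁅wreathEval n r a, y z.1⁆ (wreathEval n r b), sub_eq_add_neg]

variable (n r) in
/-- The homomorphism from `L n` which reads off the coordinates of elements of the subalgebra
`L(U ≀ Y)`: row `r` acts on `WreathFree` by the derivations `-appendDer z`. -/
noncomputable def wreathCoord : L n →ₗ⁅ℤ⁆ LieAlgebra.SemiDirectSum (WreathFree n r)
    (LieDerivation ℤ (WreathFree n r) (WreathFree n r)) LieHom.id :=
  freeLift fun a =>
    if h : r < a.row then ⟨FreeLieAlgebra.of ℤ (⟨a, h⟩, []), 0⟩
    else if h : a.row = r then ⟨0, -appendDer ⟨a, h⟩⟩ else 0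

/-- `wreathCoord` recovers an element of `WreathFree` from its value in `L n`. -/
theorem wreathCoord_wreathEval (f : WreathFree n r) :
    wreathCoord n r (wreathEval n r f) = LieAlgebra.SemiDirectSum.inl LieHom.id f := by
  have : (wreathCoord n r).comp (wreathEval n r) = LieAlgebra.SemiDirectSum.inl LieHom.id := by
    refine freeLie_hom_ext fun p => ?_
    obtain ⟨a, l⟩ := p
    rw [LieHom.comp_apply, wreathEval_of]
    induction l using List.reverseRecOn with
    | nil =>
      change wreathCoord n r (FreeLieAlgebra.of ℤ a.1) = _
      rw [wreathCoord, freeLift_of, dif_pos a.2]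
      rfl
    | append_singleton l z ih =>
      have hz : wreathCoord n r (y z.1) = ⟨0, -appendDer z⟩ := by
        rw [wreathCoord, y, freeLift_of, dif_neg (by rw [z.2]; exact lt_irrefl r), dif_pos z.2]
      rw [List.map_append, List.map_singleton, leftNormed_concat, LieHom.map_lie, ih, hz]
      simp [appendDer]
  exact congrArg (fun F => F f) this

theorem wreathEval_injective : Function.Injective (wreathEval n r) := fun f g h => by
  have := congrArg (wreathCoord n r) h
  rw [wreathCoord_wreathEval, wreathCoord_wreathEval] at this
  exact LieAlgebra.SemiDirectSum.inl_injective _ this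

theorem wreathEval_range : (wreathEval n r).range = LWreath n r := by
  apply le_antisymm
  · rintro _ ⟨f, rfl⟩
    change wreathEval n r f ∈ _
    induction f using freeLie_induction with
    | of p =>
      rw [wreathEval_of]
      have := leftNormed_mem_LWreath n r p.1.1 p.1.2 (p.2.map Subtype.val)
        (by intro z hz; obtain ⟨w, -, rfl⟩ := List.mem_map.1 hz; exact w.2)
      rwa [List.map_map] at this
    | zero => rw [map_zero]; exact zero_mem _
    | add a b h1 h2 => rw [map_add]; exact add_mem h1 h2
    | smul k a h => rw [map_zsmul]; exact zsmul_mem h k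
    | lie a b h1 h2 => rw [LieHom.map_lie]; exact LieSubalgebra.lie_mem _ h1 h2
  · refine LieSubalgebra.lieSpan_le.2 ?_
    have : wreath (U n (r + 1)) (Y n r) ≤ (wreathEval n r).range.toSubmodule := by
      refine iSup_le fun k => ?_
      rw [Y, rowSet_eq_range]
      refine (lieProdIter_span_le _ _ k).trans (Submodule.span_le.2 ?_)
      rintro _ ⟨_, ⟨a, ha, rfl⟩, l, rfl⟩
      exact ⟨FreeLieAlgebra.of ℤ (⟨a, ha⟩, l), wreathEval_of _⟩
    exact this

variable (n r) in
/-- `L(U ≀ Y)` is free on the left-normed commutators `[u, z₁, …, zₖ]`. -/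
noncomputable def wreathEquiv : WreathFree n r ≃ₗ⁅ℤ⁆ LWreath n r :=
  (LieEquiv.ofInjective (wreathEval n r) wreathEval_injective).trans
    (LieEquiv.ofEq _ _ (congrArg _ wreathEval_range))

theorem coe_wreathEquiv (f : WreathFree n r) : (wreathEquiv n r f : L n) = wreathEval n r f :=
  rfl

/-- The correction term of `Ψ` at the generator `(u, l)`: it is `-[[u, u'], z₁, …, zₖ]` if
`l = [z, z₁, …, zₖ]` and `ψ([u, z]) = [u, z] - [u, u']`, and zero otherwise. -/
noncomputable def psiCorrection : Up n r × List (Row n r) → WreathFree n r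
  | (_, []) => 0
  | (u, z :: l) =>
    if u.1.col ≤ z.1.row ∧ z.1.col ≠ u.1.col then
      -l.foldl (fun f w => appendDer w f) ⁅(FreeLieAlgebra.of ℤ (u, []) : WreathFree n r),
        (FreeLieAlgebra.of ℤ (⟨mixed u.1 z.1 (z.2.trans_lt u.2), u.2⟩, []) : WreathFree n r)⁆
    else 0

theorem appendDer_mem_rankLT (z : Row n r) {k : ℕ} {f : WreathFree n r}
    (hf : f ∈ rankLT (fun p : Up n r × List (Row n r) => p.2.length) k) :
    appendDer z f ∈ rankLT (fun p : Up n r × List (Row n r) => p.2.length) (k + 1) := by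
  have hle := rankLT_mono (fun p : Up n r × List (Row n r) => p.2.length) k.le_succ
  unfold rankLT at hf
  induction hf using LieSubalgebra.lieSpan_induction with
  | mem x hx =>
    obtain ⟨p, hp, rfl⟩ := hx
    rw [appendDer, freeDer_of]
    refine of_mem_rankLT ?_
    simpa using hp
  | zero => rw [map_zero]; exact zero_mem _
  | add a b _ _ h1 h2 => rw [map_add]; exact add_mem h1 h2
  | smul k a _ h => rw [map_zsmul]; exact zsmul_mem h k
  | lie a b ha hb h1 h2 =>
    rw [LieDerivation.apply_lie_eq_add]
    exact add_mem (LieSubalgebra.lie_mem _ (hle ha) h2) (LieSubalgebra.lie_mem _ h1 (hle hb))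

theorem foldl_appendDer_mem_rankLT (l : List (Row n r)) {k : ℕ} {f : WreathFree n r}
    (hf : f ∈ rankLT (fun p : Up n r × List (Row n r) => p.2.length) k) :
    l.foldl (fun f w => appendDer w f) f ∈
      rankLT (fun p : Up n r × List (Row n r) => p.2.length) (k + l.length) := by
  induction l generalizing k f with
  | nil => exact hf
  | cons z l ih =>
    rw [List.length_cons, ← add_assoc, add_right_comm]
    exact ih (appendDer_mem_rankLT z hf)

/-- Bracketing with `l = [z₁, …, zₖ]` lengthens the symbols by at most `k`, one less than the
length of `z :: l`. -/
theorem psiCorrection_mem_rankLT (p : Up n r × List (Row n r)) :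
    psiCorrection p ∈ rankLT (fun p : Up n r × List (Row n r) => p.2.length) p.2.length := by
  obtain ⟨u, _ | ⟨z, l⟩⟩ := p
  · exact zero_mem _
  · rw [psiCorrection]
    split_ifs
    · refine neg_mem ?_
      rw [List.length_cons, add_comm]
      exact foldl_appendDer_mem_rankLT l
        (LieSubalgebra.lie_mem _ (of_mem_rankLT Nat.one_pos) (of_mem_rankLT Nat.one_pos))
    · exact zero_mem _

theorem wreathEval_foldl_appendDer (l : List (Row n r)) (f : WreathFree n r) :
    wreathEval n r (l.foldl (fun f w => appendDer w f) f) =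
      leftNormed (wreathEval n r f) (l.map fun z => y z.1) := by
  induction l generalizing f with
  | nil => rfl
  | cons z l ih =>
    rw [List.foldl_cons, ih, wreathEval_appendDer]
    rfl

theorem leftNormed_sub {𝔤 : Type*} [LieRing 𝔤] (a b : 𝔤) (l : List 𝔤) :
    leftNormed (a - b) l = leftNormed a l - leftNormed b l := by
  induction l generalizing a b with
  | nil => rfl
  | cons z l ih =>
    change leftNormed ⁅a - b, z⁆ l = leftNormed ⁅a, z⁆ l - leftNormed ⁅b, z⁆ l
    rw [sub_lie, ih]

theorem wreathEval_perturb_nil (u : Up n r) :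
    wreathEval n r (perturb psiCorrection (FreeLieAlgebra.of ℤ (u, []))) = y u.1 := by
  rw [perturb_of, psiCorrection, add_zero, wreathEval_of]
  rfl

theorem wreathEval_perturb_cons (u : Up n r) (z : Row n r) (l : List (Row n r)) :
    wreathEval n r (perturb psiCorrection (FreeLieAlgebra.of ℤ (u, z :: l))) =
      leftNormed (psi2 u.1 z.1 (z.2.trans_lt u.2)) (l.map fun z => y z.1) := by
  rw [perturb_of, psiCorrection, psi2]
  split_ifs
  · rw [map_add, wreathEval_of, map_neg, wreathEval_foldl_appendDer, LieHom.map_lie,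
      wreathEval_of, wreathEval_of, leftNormed_sub, ← sub_eq_add_neg]
    rfl
  · rw [add_zero, wreathEval_of]
    rfl

variable (n r) in
/-- The automorphism `Ψ`. -/
noncomputable def psiEquiv : LWreath n r ≃ₗ⁅ℤ⁆ LWreath n r :=
  (wreathEquiv n r).symm.trans
    ((LieEquiv.ofBijective _ (perturb_bijective psiCorrection_mem_rankLT)).trans
      (wreathEquiv n r))

theorem coe_psiEquiv_apply (f : WreathFree n r) {x : LWreath n r}
    (hx : (x : L n) = wreathEval n r f) :
    (psiEquiv n r x : L n) = wreathEval n r (perturb psiCorrection f) := by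
  obtain rfl : x = wreathEquiv n r f := Subtype.ext hx
  have : psiEquiv n r (wreathEquiv n r f) = wreathEquiv n r (perturb psiCorrection f) :=
    congrArg (fun g => wreathEquiv n r (perturb psiCorrection g))
      ((wreathEquiv n r).symm_apply_apply f)
  rw [this, coe_wreathEquiv]

theorem psiEquiv_isPsi : IsPsi n r (psiEquiv n r) := by
  refine ⟨fun u hu => ?_, fun u z hu hz zs hzs => ?_⟩
  · rw [coe_psiEquiv_apply (FreeLieAlgebra.of ℤ (⟨u, hu⟩, [])), wreathEval_perturb_nil]
    rw [wreathEval_of]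
    rfl
  · obtain ⟨l, rfl⟩ : ∃ l : List (Row n r), l.map Subtype.val = zs := CanLift.prf zs hzs
    refine (coe_psiEquiv_apply (FreeLieAlgebra.of ℤ (⟨u, hu⟩, ⟨z, hz⟩ :: l))
      (wreathEval_of_cons ⟨u, hu⟩ ⟨z, hz⟩ l).symm).trans ?_
    rw [wreathEval_perturb_cons, List.map_map]
    rfl

/-- The prescribed values determine `Ψ` on the free generators of `L(U ≀ Y)`. -/
theorem IsPsi.eq {Φ Ψ : LWreath n r ≃ₗ⁅ℤ⁆ LWreath n r} (hΦ : IsPsi n r Φ) (hΨ : IsPsi n r Ψ) :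
    Φ = Ψ := by
  have key : Φ.toLieHom.comp (wreathEquiv n r).toLieHom =
      Ψ.toLieHom.comp (wreathEquiv n r).toLieHom := by
    refine freeLie_hom_ext fun p => Subtype.ext ?_
    obtain ⟨⟨u, hu⟩, _ | ⟨⟨z, hz⟩, l⟩⟩ := p
    · have hx : wreathEquiv n r (FreeLieAlgebra.of ℤ (⟨u, hu⟩, [])) =
          ⟨y u, leftNormed_mem_LWreath n r u hu [] (by simp)⟩ :=
        Subtype.ext (wreathEval_of _)
      change (Φ (wreathEquiv n r _) : L n) = Ψ (wreathEquiv n r _)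
      rw [hx, hΦ.1 u hu, hΨ.1 u hu]
    · have hl : ∀ w ∈ l.map Subtype.val, w.row = r := by
        intro w hw; obtain ⟨v, -, rfl⟩ := List.mem_map.1 hw; exact v.2
      have hx : wreathEquiv n r (FreeLieAlgebra.of ℤ (⟨u, hu⟩, ⟨z, hz⟩ :: l)) =
          ⟨leftNormed ⁅y u, y z⁆ ((l.map Subtype.val).map y), leftNormed_mem_LWreath n r u hu
            (z :: l.map Subtype.val) (List.forall_mem_cons.2 ⟨hz, hl⟩)⟩ :=
        Subtype.ext (wreathEval_of_cons _ _ _)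
      change (Φ (wreathEquiv n r _) : L n) = Ψ (wreathEquiv n r _)
      rw [hx, hΦ.2 u z hu hz _ hl, hΨ.2 u z hu hz _ hl]
  ext x
  obtain ⟨f, rfl⟩ := (wreathEquiv n r).surjective x
  exact congrArg (fun F => ((F f : LWreath n r) : L n)) key

end Elimination

/-! ### Lower rows acting on higher rows by derivations -/

section RowAction

variable {n : ℕ}

/-- The case distinction `b.col ≠ a.col` is immaterial, since `mixed a b h = a` if the columns
agree. -/
theorem psi2_eq (a b : Gen n) (h : b.row < a.row) :
    psi2 a b h = ⁅y a, y b⁆ - if a.col ≤ b.row then ⁅y a, y (mixed a b h)⁆ else 0 := by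
  rw [psi2]
  by_cases h1 : a.col ≤ b.row
  · by_cases h2 : b.col = a.col
    · have : mixed a b h = a := Gen.ext rfl h2
      simp [h2, this]
    · simp [h1, h2]
  · simp [h1]

/-- The three families of relators together are the elements `ψ([y_{mi}, y_{rj}])`; for `i = j` and
for `r < i` the element is the plain commutator. -/
theorem relators_eq : relators n = {x | ∃ (a b : Gen n) (h : b.row < a.row), x = psi2 a b h} := by
  ext x
  constructor
  · rintro ((⟨a, b, h, hc, rfl⟩ | ⟨a, b, h, rfl⟩) | ⟨a, b, h, h1, h2, rfl⟩)
    · exact ⟨a, b, h, by simp [psi2, hc]⟩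
    · exact ⟨a, b, h.trans_le a.col_le, by simp [psi2, Nat.not_le.2 h]⟩
    · exact ⟨a, b, h, by simp [psi2, h1, h2]⟩
  · rintro ⟨a, b, h, rfl⟩
    by_cases h1 : a.col ≤ b.row
    · by_cases h2 : b.col = a.col
      · exact Or.inl (Or.inl ⟨a, b, h, h2.symm, by simp [psi2, h2]⟩)
      · exact Or.inr ⟨a, b, h, h1, h2, by simp [psi2, h1, h2]⟩
    · exact Or.inl (Or.inr ⟨a, b, Nat.not_le.1 h1, by simp [psi2, h1]⟩)

variable (r t : ℕ)

/-- The partial inner derivation `y_{mi} ↦ [y_{mi}, y_{mj}]` for `i ≤ s` of rows `r < m ≤ t`,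
where `a = (s, j)`; all other generators go to zero. -/
noncomputable def rowDer (a : Gen n) : LieDerivation ℤ (L n) (L n) :=
  freeDer fun c =>
    if h : a.row < c.row ∧ (r < c.row ∧ c.row ≤ t) ∧ c.col ≤ a.row then
      ⁅y c, y (mixed c a h.1)⁆ else 0

variable {r t}

theorem rowDer_y {a c : Gen n} (ha : a.row < c.row) (hc : r < c.row ∧ c.row ≤ t) :
    rowDer r t a (y c) = if c.col ≤ a.row then ⁅y c, y (mixed c a ha)⁆ else 0 := by
  rw [rowDer, y, freeDer_of]
  simp only [ha, hc, true_and, and_self]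
  split_ifs <;> rfl

theorem rowDer_y_eq_zero {a c : Gen n} (hc : ¬ (r < c.row ∧ c.row ≤ t)) :
    rowDer r t a (y c) = 0 := by
  rw [rowDer, y, freeDer_of, dif_neg fun h => hc h.2.1]

theorem rowDer_y_of_le {a c : Gen n} (ha : a.row < c.row) (hc : r < c.row ∧ c.row ≤ t)
    (h : c.col ≤ a.row) : rowDer r t a (y c) = ⁅y c, y (mixed c a ha)⁆ := by
  rw [rowDer_y ha hc, if_pos h]

theorem rowDer_y_of_lt {a c : Gen n} (h : a.row < c.col) : rowDer r t a (y c) = 0 := by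
  by_cases hc : r < c.row ∧ c.row ≤ t
  · rw [rowDer_y (h.trans_le c.col_le) hc, if_neg h.not_ge]
  · exact rowDer_y_eq_zero hc

/-- The partial inner derivations satisfy the relations between the lower rows. -/
theorem lie_rowDer {a b : Gen n} (h : b.row < a.row) (ha : a.row ≤ r) :
    ⁅rowDer r t a, rowDer r t b⁆ =
      if a.col ≤ b.row then ⁅rowDer r t a, rowDer r t (mixed a b h)⁆ else 0 := by
  refine freeDer_ext fun c => ?_
  change ⁅rowDer r t a, rowDer r t b⁆ (y c) = _
  change _ = (ite _ _ _ : LieDerivation ℤ (L n) (L n)) (y c)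
  by_cases hc : r < c.row ∧ c.row ≤ t
  swap
  · split_ifs <;> simp [LieDerivation.lie_apply, rowDer_y_eq_zero hc]
  have hac : a.row < c.row := ha.trans_lt hc.1
  have hbc : b.row < c.row := h.trans hac
  by_cases hca : c.col ≤ a.row
  swap
  · have h1 : rowDer r t a (y c) = 0 := rowDer_y_of_lt (Nat.not_le.1 hca)
    have h2 : rowDer r t b (y c) = 0 := rowDer_y_of_lt (h.trans (Nat.not_le.1 hca))
    have h3 : rowDer r t (mixed a b h) (y c) = 0 := rowDer_y_of_lt (Nat.not_le.1 hca)
    split_ifs <;> simp [LieDerivation.lie_apply, h1, h2, h3]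
  have h1 : rowDer r t a (y c) = ⁅y c, y (mixed c a hac)⁆ := rowDer_y_of_le hac hc hca
  have h2 : rowDer r t (mixed a b h) (y c) = ⁅y c, y (mixed c b hbc)⁆ :=
    rowDer_y_of_le (a := mixed a b h) hac hc hca
  have h3 : rowDer r t a (y (mixed c b hbc)) = ⁅y (mixed c b hbc), y (mixed c a hac)⁆ :=
    rowDer_y_of_le (c := mixed c b hbc) hac hc (b.col_le.trans h.le)
  have h4 : rowDer r t (mixed a b h) (y (mixed c a hac)) =
      ⁅y (mixed c a hac), y (mixed c b hbc)⁆ :=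
    rowDer_y_of_le (a := mixed a b h) (c := mixed c a hac) hac hc a.col_le
  have h5 : rowDer r t b (y (mixed c a hac)) =
      if a.col ≤ b.row then ⁅y (mixed c a hac), y (mixed c b hbc)⁆ else 0 :=
    rowDer_y (c := mixed c a hac) hbc hc
  have h6 : rowDer r t b (y c) = if c.col ≤ b.row then ⁅y c, y (mixed c b hbc)⁆ else 0 :=
    rowDer_y hbc hc
  -- both sides are now iterated commutators of `y c`, `y (mixed c a)` and `y (mixed c b)`
  generalize y (mixed c a hac) = p at *
  generalize y (mixed c b hbc) = q at *
  generalize y c = x at *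
  rw [LieDerivation.lie_apply, h1, LieDerivation.apply_lie_eq_add, h5, h6]
  by_cases hab : a.col ≤ b.row
  · rw [if_pos hab, if_pos hab, LieDerivation.lie_apply, h1, h2,
      LieDerivation.apply_lie_eq_add, LieDerivation.apply_lie_eq_add, h1, h2, h3, h4]
    split_ifs
    · rw [LieDerivation.apply_lie_eq_add, h1, h3]
    · rw [map_zero]
      grind [lie_skew, lie_lie, zero_lie]
  · rw [if_neg hab, if_neg hab, lie_zero, LieDerivation.zero_apply]
    split_ifs
    · rw [LieDerivation.apply_lie_eq_add, h1, h3]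
      grind [lie_skew, lie_lie]
    · simp

variable (r t)

variable (n) in
/-- The homomorphism which kills the rows above `t`, keeps the rows `m` with `r < m ≤ t`, and
lets the rows up to `r` act on these by partial inner derivations. -/
noncomputable def rowAction : L n →ₗ⁅ℤ⁆
    LieAlgebra.SemiDirectSum (L n) (LieDerivation ℤ (L n) (L n)) LieHom.id :=
  freeLift fun a =>
    if a.row ≤ r then ⟨0, -rowDer r t a⟩ else if a.row ≤ t then ⟨y a, 0⟩ else 0

variable (n) in
/-- The component of `rowAction` in the rows between `r` and `t`. -/
noncomputable def rowProj : L n →ₗ[ℤ] L n :=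
  (LieAlgebra.SemiDirectSum.projl LieHom.id).comp (rowAction n r t).toLinearMap

variable {r t}

theorem rowProj_eq (x : L n) : rowProj n r t x = (rowAction n r t x).left := rfl

theorem rowAction_y_low {a : Gen n} (h : a.row ≤ r) :
    rowAction n r t (y a) = ⟨0, -rowDer r t a⟩ := by
  rw [rowAction, y, freeLift_of, if_pos h]

theorem rowAction_y_mid {a : Gen n} (h : r < a.row) (h' : a.row ≤ t) :
    rowAction n r t (y a) = ⟨y a, 0⟩ := by
  rw [rowAction, y, freeLift_of, if_neg h.not_ge, if_pos h']; rfl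

theorem rowAction_y_high {a : Gen n} (h : r < a.row) (h' : t < a.row) :
    rowAction n r t (y a) = 0 := by
  rw [rowAction, y, freeLift_of, if_neg h.not_ge, if_neg h'.not_ge]

/-- The relator of `a` and `b` dies if the row of `b` acts by derivations, or if the row of `a`
is killed. -/
theorem rowAction_psi2 {a b : Gen n} (h : b.row < a.row)
    (hr : b.row ≤ r ∨ (r < a.row ∧ t < a.row)) :
    rowAction n r t (psi2 a b h) = 0 := by
  rw [psi2_eq]
  by_cases ht : r < a.row ∧ t < a.row
  · split_ifs <;> simp [rowAction_y_high ht.1 ht.2]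
  have hb : b.row ≤ r := hr.resolve_right ht
  rw [map_sub, LieHom.map_lie, rowAction_y_low hb]
  by_cases ha : a.row ≤ r
  · have := lie_rowDer (t := t) h ha
    split_ifs at this ⊢ with h1
    · rw [LieHom.map_lie, rowAction_y_low ha, rowAction_y_low (a := mixed a b h) ha]
      simp [this]
    · rw [rowAction_y_low ha]
      simp [this]
  · have ha' := Nat.not_le.1 ha
    have hat : a.row ≤ t := by
      by_contra h'
      exact ht ⟨ha', Nat.not_le.1 h'⟩
    have hD := rowDer_y (r := r) (t := t) h ⟨ha', hat⟩
    split_ifs at hD ⊢ with h1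
    · rw [LieHom.map_lie, rowAction_y_mid ha' hat,
        rowAction_y_mid (a := mixed a b h) ha' hat]
      simp [hD]
    · rw [rowAction_y_mid ha' hat]
      simp [hD]

theorem rowAction_mid {S : Set (L n)}
    (hS : ∀ x ∈ S, ∃ a : Gen n, (r < a.row ∧ a.row ≤ t) ∧ x = y a)
    {x : L n} (hx : x ∈ LieSubalgebra.lieSpan ℤ (L n) S) :
    rowAction n r t x = LieAlgebra.SemiDirectSum.inl LieHom.id x := by
  induction hx using LieSubalgebra.lieSpan_induction with
  | mem x hx => obtain ⟨a, ha, rfl⟩ := hS x hx; rw [rowAction_y_mid ha.1 ha.2]; rfl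
  | zero => rw [map_zero, map_zero]
  | add x y _ _ h1 h2 => rw [map_add, map_add, h1, h2]
  | smul k x _ h => rw [map_zsmul, map_zsmul, h]
  | lie x y _ _ h1 h2 => rw [LieHom.map_lie, LieHom.map_lie, h1, h2]

theorem rowAction_low {S : Set (L n)} (hS : ∀ x ∈ S, ∃ a : Gen n, a.row ≤ r ∧ x = y a)
    {x : L n} (hx : x ∈ LieSubalgebra.lieSpan ℤ (L n) S) : (rowAction n r t x).left = 0 := by
  induction hx using LieSubalgebra.lieSpan_induction with
  | mem x hx => obtain ⟨a, ha, rfl⟩ := hS x hx; rw [rowAction_y_low ha]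
  | zero => rw [map_zero]; rfl
  | add x y _ _ h1 h2 => rw [map_add, LieAlgebra.SemiDirectSum.add_eq_mk, h1, h2, add_zero]
  | smul k x _ h =>
    rw [map_zsmul]
    exact (congrArg (k • ·) h).trans (smul_zero k)
  | lie x y _ _ h1 h2 =>
    rw [LieHom.map_lie, LieAlgebra.SemiDirectSum.lie_eq_mk, h1, h2]
    simp

theorem rowAction_high {S : Set (L n)}
    (hS : ∀ x ∈ S, ∃ a : Gen n, (r < a.row ∧ t < a.row) ∧ x = y a)
    {x : L n} (hx : x ∈ LieSubalgebra.lieSpan ℤ (L n) S) : rowAction n r t x = 0 := by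
  induction hx using LieSubalgebra.lieSpan_induction with
  | mem x hx => obtain ⟨a, ha, rfl⟩ := hS x hx; exact rowAction_y_high ha.1 ha.2
  | zero => rw [map_zero]
  | add x y _ _ h1 h2 => rw [map_add, h1, h2, add_zero]
  | smul k x _ h => rw [map_zsmul, h, smul_zero]
  | lie x y _ _ h1 h2 => rw [LieHom.map_lie, h1, h2, lie_zero]

end RowAction

/-! ### The subalgebras `L(Ψ(W))` -/

section PsiW

variable {n r : ℕ}

theorem lieProd_span_span {𝔤 : Type*} [LieRing 𝔤] (S T : Set 𝔤) :
    lieProd (Submodule.span ℤ S) (Submodule.span ℤ T) =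
      Submodule.span ℤ (Set.image2 (fun a b => ⁅a, b⁆) S T) :=
  le_antisymm
    (lieProd_span_le fun s hs t ht => Submodule.subset_span ⟨s, hs, t, ht, rfl⟩)
    (Submodule.span_mono (Set.image2_subset Submodule.subset_span Submodule.subset_span))

theorem lieProd_le_of_mem {𝔤 : Type*} [LieRing 𝔤] {A N : Submodule ℤ 𝔤} {T : Set 𝔤}
    (h : ∀ a ∈ A, ∀ t ∈ T, ⁅a, t⁆ ∈ N) : lieProd A (Submodule.span ℤ T) ≤ N := by
  rw [← Submodule.span_eq A]
  exact lieProd_span_le h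

theorem leftNormed_mem {𝔤 : Type*} [LieRing 𝔤] {K : LieSubalgebra ℤ 𝔤} {x : 𝔤} (hx : x ∈ K)
    {l : List 𝔤} (hl : ∀ z ∈ l, z ∈ K) : leftNormed x l ∈ K := by
  induction l generalizing x with
  | nil => exact hx
  | cons z l ih =>
    exact ih (K.lie_mem hx (hl z List.mem_cons_self)) fun w hw => hl w (List.mem_cons_of_mem _ hw)

theorem W_le {N : Submodule ℤ (L n)}
    (h₁ : ∀ (u : Up n r) (z : Row n r) (l : List (Row n r)),
      leftNormed ⁅y u.1, y z.1⁆ (l.map fun z => y z.1) ∈ N)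
    (h₂ : ∀ u : Up n r, ∀ x ∈ N, ⁅x, y u.1⁆ ∈ N) : W n r ≤ N := by
  refine iSup₂_le fun a b => ?_
  induction b with
  | zero =>
    change lieProdIter (lieProd (U n (r + 1)) (Y n r)) (Y n r) a ≤ N
    rw [U, Y, lieProd_span_span, rowSet_eq_range]
    refine (lieProdIter_span_le _ _ a).trans (Submodule.span_le.2 ?_)
    rintro _ ⟨_, ⟨_, ⟨u, hu, rfl⟩, _, ⟨z, rfl⟩, rfl⟩, l, rfl⟩
    exact h₁ ⟨u, hu⟩ z l
  | succ b ih =>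
    refine lieProd_le_of_mem ?_
    rintro x hx _ ⟨u, hu, rfl⟩
    exact h₂ ⟨u, hu⟩ x (ih hx)

theorem leftNormed_mem_W (u : Up n r) (z : Row n r) (l : List (Row n r)) :
    leftNormed ⁅y u.1, y z.1⁆ (l.map fun z => y z.1) ∈ W n r := by
  refine Submodule.mem_iSup_of_mem (0 + (l.map fun z => y (n := n) z.1).length)
    (Submodule.mem_iSup_of_mem 0 ?_)
  refine leftNormed_mem_lieProdIter _ _ _ ?_ 0 _ ?_
  · intro w hw
    obtain ⟨v, -, rfl⟩ := List.mem_map.1 hw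
    exact Submodule.subset_span ⟨v.1, v.2, rfl⟩
  · exact Submodule.subset_span ⟨y u.1, Submodule.subset_span ⟨u.1, u.2, rfl⟩, y z.1,
      Submodule.subset_span ⟨z.1, z.2, rfl⟩, rfl⟩

theorem lie_mem_W (u : Up n r) {x : L n} (hx : x ∈ W n r) : ⁅x, y u.1⁆ ∈ W n r := by
  have : W n r ≤ (W n r).comap (LieModule.toEnd ℤ (L n) (L n) (y u.1) : L n →ₗ[ℤ] L n) := by
    refine iSup₂_le fun a b x hx => ?_
    rw [Submodule.mem_comap, LieModule.toEnd_apply_apply, ← lie_skew, neg_mem_iff]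
    exact Submodule.mem_iSup_of_mem a (Submodule.mem_iSup_of_mem (b + 1)
      (Submodule.subset_span ⟨x, hx, y u.1, Submodule.subset_span ⟨u.1, u.2, rfl⟩, rfl⟩))
  have h := this hx
  rwa [Submodule.mem_comap, LieModule.toEnd_apply_apply, ← lie_skew, neg_mem_iff] at h

theorem y_mem_LWreath (u : Up n r) : y u.1 ∈ LWreath n r :=
  leftNormed_mem_LWreath n r u.1 u.2 [] (by simp)

theorem leftNormed_lie_mem_LWreath (u : Up n r) (z : Row n r) (l : List (Row n r)) :
    leftNormed ⁅y u.1, y z.1⁆ (l.map fun z => y z.1) ∈ LWreath n r := by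
  rw [← wreathEval_range]
  exact ⟨FreeLieAlgebra.of ℤ (u, z :: l), wreathEval_of _⟩

theorem W_le_LWreath : W n r ≤ (LWreath n r).toSubmodule :=
  W_le leftNormed_lie_mem_LWreath fun u _ hx => LieSubalgebra.lie_mem _ hx (y_mem_LWreath u)

theorem wreath_le : wreath (U n (r + 1)) (Y n r) ≤ U n (r + 1) ⊔ W n r := by
  refine iSup_le fun k => ?_
  nth_rw 1 [U]
  rw [Y, rowSet_eq_range]
  refine (lieProdIter_span_le _ _ k).trans (Submodule.span_le.2 ?_)
  rintro _ ⟨_, ⟨u, hu, rfl⟩, _ | ⟨z, l⟩, rfl⟩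
  · exact Submodule.mem_sup_left (Submodule.subset_span ⟨u, hu, rfl⟩)
  · exact Submodule.mem_sup_right (leftNormed_mem_W ⟨u, hu⟩ z l)

theorem lie_mem_wreath (z : Row n r) {x : L n} (hx : x ∈ wreath (U n (r + 1)) (Y n r)) :
    ⁅x, y z.1⁆ ∈ wreath (U n (r + 1)) (Y n r) := by
  have : wreath (U n (r + 1)) (Y n r) ≤ (wreath (U n (r + 1)) (Y n r)).comap
      (LieModule.toEnd ℤ (L n) (L n) (y z.1) : L n →ₗ[ℤ] L n) := by
    refine iSup_le fun k x hx => ?_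
    rw [Submodule.mem_comap, LieModule.toEnd_apply_apply, ← lie_skew, neg_mem_iff]
    exact Submodule.mem_iSup_of_mem (k + 1)
      (Submodule.subset_span ⟨x, hx, y z.1, Submodule.subset_span ⟨z.1, z.2, rfl⟩, rfl⟩)
  have h := this hx
  rwa [Submodule.mem_comap, LieModule.toEnd_apply_apply, ← lie_skew, neg_mem_iff] at h

variable (n) in
/-- The subalgebra generated by the rows from `r` on. -/
noncomputable def LU (r : ℕ) : LieSubalgebra ℤ (L n) :=
  LieSubalgebra.lieSpan ℤ (L n) (upperSet n r)

theorem LU_le_LY_sup_LWreath :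
    (LU n r).toSubmodule ≤ (LY n r).toSubmodule ⊔ (LWreath n r).toSubmodule := by
  have h : LU n r ≤ LieSubalgebra.lieSpan ℤ (L n)
      (rowSet n r ∪ wreath (U n (r + 1)) (Y n r)) := by
    refine LieSubalgebra.lieSpan_mono ?_
    rintro _ ⟨a, ha, rfl⟩
    rcases ha.eq_or_lt with h | h
    · exact Or.inl ⟨a, h.symm, rfl⟩
    · exact Or.inr (Submodule.mem_iSup_of_mem 0
        (show y a ∈ U n (r + 1) from
          Submodule.subset_span (s := upperSet n (r + 1)) ⟨a, h, rfl⟩))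
  refine le_trans h (lieSpan_union_le_sup ?_)
  rintro _ ⟨z, hz, rfl⟩ t ht
  exact LieSubalgebra.subset_lieSpan (lie_mem_wreath (r := r) ⟨z, hz⟩ ht)

theorem LWreath_le_LU : LWreath n r ≤ LU n r := by
  rw [← wreathEval_range]
  rintro _ ⟨f, rfl⟩
  change wreathEval n r f ∈ _
  induction f using freeLie_induction with
  | of p =>
    rw [wreathEval_of]
    have hu : y p.1.1 ∈ LU n r := LieSubalgebra.subset_lieSpan ⟨p.1.1, p.1.2.le, rfl⟩
    refine leftNormed_mem hu ?_
    intro z hz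
    obtain ⟨w, -, rfl⟩ := List.mem_map.1 hz
    exact LieSubalgebra.subset_lieSpan ⟨w.1, w.2.ge, rfl⟩
  | zero => rw [map_zero]; exact zero_mem _
  | add a b h1 h2 => rw [map_add]; exact add_mem h1 h2
  | smul k a h => rw [map_zsmul]; exact zsmul_mem h k
  | lie a b h1 h2 => rw [LieHom.map_lie]; exact LieSubalgebra.lie_mem _ h1 h2

theorem LWreath_le_LU_sup_lieSpan_W :
    (LWreath n r).toSubmodule ≤
      (LU n (r + 1)).toSubmodule ⊔
        (LieSubalgebra.lieSpan ℤ (L n) (W n r : Set (L n))).toSubmodule := by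
  have h : LWreath n r ≤ LieSubalgebra.lieSpan ℤ (L n) (upperSet n (r + 1) ∪ W n r) := by
    refine LieSubalgebra.lieSpan_le.2 ?_
    have : wreath (U n (r + 1)) (Y n r) ≤
        (LieSubalgebra.lieSpan ℤ (L n) (upperSet n (r + 1) ∪ W n r)).toSubmodule :=
      wreath_le.trans (sup_le
        (Submodule.span_le.2 fun x hx => LieSubalgebra.subset_lieSpan (Or.inl hx))
        fun x hx => LieSubalgebra.subset_lieSpan (Or.inr hx))
    exact this
  refine le_trans h (lieSpan_union_le_sup ?_)
  rintro _ ⟨u, hu, rfl⟩ t ht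
  exact LieSubalgebra.subset_lieSpan (lie_mem_W ⟨u, hu⟩ ht)

theorem LU_le_LWreath : LU n (r + 1) ≤ LWreath n r := by
  refine LieSubalgebra.lieSpan_le.2 ?_
  rintro _ ⟨u, hu, rfl⟩
  exact y_mem_LWreath ⟨u, hu⟩

variable {Ψ : LWreath n r ≃ₗ⁅ℤ⁆ LWreath n r}

theorem LPsiW_le_LWreath : LPsiW r Ψ ≤ LWreath n r := by
  refine LieSubalgebra.lieSpan_le.2 ?_
  rintro _ ⟨w, -, rfl⟩
  exact (Ψ w).2

theorem IsPsi.apply_of_mem_LU (hΨ : IsPsi n r Ψ) {x : L n} (hx : x ∈ LU n (r + 1)) :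
    (Ψ ⟨x, LU_le_LWreath hx⟩ : L n) = x := by
  unfold LU at hx
  induction hx using LieSubalgebra.lieSpan_induction with
  | mem x hx => obtain ⟨u, hu, rfl⟩ := hx; exact hΨ.1 u hu
  | zero => exact congrArg Subtype.val (map_zero Ψ)
  | add a b ha hb h1 h2 =>
    exact (congrArg Subtype.val (map_add Ψ ⟨a, LU_le_LWreath ha⟩ ⟨b, LU_le_LWreath hb⟩)).trans
      (congrArg₂ (· + ·) h1 h2)
  | smul k a ha h =>
    exact (congrArg Subtype.val (map_zsmul Ψ k ⟨a, LU_le_LWreath ha⟩)).trans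
      (congrArg (k • ·) h)
  | lie a b ha hb h1 h2 =>
    exact (congrArg Subtype.val
      (LieEquiv.map_lie Ψ ⟨a, LU_le_LWreath ha⟩ ⟨b, LU_le_LWreath hb⟩)).trans
      (congrArg₂ (fun a b => ⁅a, b⁆) h1 h2)

/-- To show that `Ψ(W)` lies in a submodule, it is enough to look at the images of the left-normed
commutators `[u, z, z₁, …, zₖ]` and to bracket with the rows above `r`, which `Ψ` fixes. -/
theorem IsPsi.apply_mem_of_mem_W (hΨ : IsPsi n r Ψ) {N : Submodule ℤ (L n)}
    (h₁ : ∀ (u : Up n r) (z : Row n r) (l : List (Row n r)),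
      leftNormed (psi2 u.1 z.1 (z.2.trans_lt u.2)) (l.map fun z => y z.1) ∈ N)
    (h₂ : ∀ u : Up n r, ∀ x ∈ N, ⁅x, y u.1⁆ ∈ N) {w : LWreath n r} (hw : (w : L n) ∈ W n r) :
    (Ψ w : L n) ∈ N := by
  let Q : Submodule ℤ (L n) :=
    { carrier := {x | ∃ h : x ∈ LWreath n r, (Ψ ⟨x, h⟩ : L n) ∈ N}
      zero_mem' := ⟨zero_mem _, by
        change (Ψ 0 : L n) ∈ N
        rw [map_zero]
        exact N.zero_mem⟩
      add_mem' := by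
        rintro a b ⟨ha, ha'⟩ ⟨hb, hb'⟩
        refine ⟨add_mem ha hb, ?_⟩
        have : (Ψ (⟨a, ha⟩ + ⟨b, hb⟩) : L n) = Ψ ⟨a, ha⟩ + Ψ ⟨b, hb⟩ :=
          congrArg Subtype.val (map_add Ψ ⟨a, ha⟩ ⟨b, hb⟩)
        exact this ▸ N.add_mem ha' hb'
      smul_mem' := by
        rintro k a ⟨ha, ha'⟩
        refine ⟨zsmul_mem ha k, ?_⟩
        have : (Ψ (k • ⟨a, ha⟩) : L n) = k • (Ψ ⟨a, ha⟩ : L n) :=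
          congrArg Subtype.val (map_zsmul Ψ k ⟨a, ha⟩)
        exact this ▸ N.smul_mem k ha' }
  have hQ : W n r ≤ Q := by
    refine W_le (fun u z l => ⟨leftNormed_lie_mem_LWreath u z l, ?_⟩) ?_
    · have := hΨ.2 u.1 z.1 u.2 z.2 (l.map Subtype.val)
        (by intro w hw; obtain ⟨v, -, rfl⟩ := List.mem_map.1 hw; exact v.2)
      simp only [List.map_map] at this
      exact this ▸ h₁ u z l
    · rintro u x ⟨hx, hx'⟩
      refine ⟨LieSubalgebra.lie_mem _ hx (y_mem_LWreath u), ?_⟩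
      have : (Ψ ⁅(⟨x, hx⟩ : LWreath n r), (⟨y u.1, y_mem_LWreath u⟩ : LWreath n r)⁆ : L n) =
          ⁅(Ψ ⟨x, hx⟩ : L n), y u.1⁆ :=
        (congrArg Subtype.val (LieEquiv.map_lie Ψ ⟨x, hx⟩ ⟨y u.1, y_mem_LWreath u⟩)).trans
          (congrArg (fun b => ⁅(Ψ ⟨x, hx⟩ : L n), b⁆) (hΨ.1 u.1 u.2))
      exact this ▸ h₂ u _ hx'
  obtain ⟨_, h⟩ := hQ hw
  exact h

theorem apply_mem_LPsiW {x : L n} (hx : x ∈ LieSubalgebra.lieSpan ℤ (L n) (W n r : Set (L n))) :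
    ∃ h : x ∈ LWreath n r, (Ψ ⟨x, h⟩ : L n) ∈ LPsiW r Ψ := by
  induction hx using LieSubalgebra.lieSpan_induction with
  | mem x hx => exact ⟨W_le_LWreath hx, LieSubalgebra.subset_lieSpan ⟨⟨x, _⟩, hx, rfl⟩⟩
  | zero =>
    refine ⟨zero_mem _, ?_⟩
    change (Ψ 0 : L n) ∈ LPsiW r Ψ
    rw [map_zero]
    exact zero_mem (LPsiW r Ψ)
  | add a b _ _ h1 h2 =>
    obtain ⟨ha, ha'⟩ := h1
    obtain ⟨hb, hb'⟩ := h2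
    refine ⟨add_mem ha hb, ?_⟩
    have : (Ψ (⟨a, ha⟩ + ⟨b, hb⟩) : L n) = Ψ ⟨a, ha⟩ + Ψ ⟨b, hb⟩ :=
      congrArg Subtype.val (map_add Ψ ⟨a, ha⟩ ⟨b, hb⟩)
    exact this ▸ add_mem ha' hb'
  | smul k a _ h =>
    obtain ⟨ha, ha'⟩ := h
    refine ⟨zsmul_mem ha k, ?_⟩
    have : (Ψ (k • ⟨a, ha⟩) : L n) = k • (Ψ ⟨a, ha⟩ : L n) :=
      congrArg Subtype.val (map_zsmul Ψ k ⟨a, ha⟩)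
    exact this ▸ zsmul_mem ha' k
  | lie a b _ _ h1 h2 =>
    obtain ⟨ha, ha'⟩ := h1
    obtain ⟨hb, hb'⟩ := h2
    refine ⟨LieSubalgebra.lie_mem _ ha hb, ?_⟩
    have : (Ψ ⁅(⟨a, ha⟩ : LWreath n r), (⟨b, hb⟩ : LWreath n r)⁆ : L n) =
        ⁅(Ψ ⟨a, ha⟩ : L n), (Ψ ⟨b, hb⟩ : L n)⁆ :=
      congrArg Subtype.val (LieEquiv.map_lie Ψ ⟨a, ha⟩ ⟨b, hb⟩)
    exact this ▸ LieSubalgebra.lie_mem _ ha' hb'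

/-- The image of `L(U ≀ Y) = L(U) + L(W)` under `Ψ`. -/
theorem IsPsi.LWreath_le (hΨ : IsPsi n r Ψ) :
    (LWreath n r).toSubmodule ≤ (LU n (r + 1)).toSubmodule ⊔ (LPsiW r Ψ).toSubmodule := by
  intro x hx
  obtain ⟨x', hx'⟩ := Ψ.surjective ⟨x, hx⟩
  obtain ⟨a, ha, w, hw, haw⟩ := Submodule.mem_sup.1 (LWreath_le_LU_sup_lieSpan_W x'.2)
  obtain ⟨hw', hΨw⟩ := apply_mem_LPsiW (Ψ := Ψ) hw
  have hx'' : x' = ⟨a, LU_le_LWreath ha⟩ + ⟨w, hw'⟩ := Subtype.ext haw.symm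
  have h : x = a + Ψ ⟨w, hw'⟩ := by
    have := congrArg Subtype.val hx'
    rw [hx'', map_add] at this
    exact this.symm.trans (congrArg (· + (Ψ ⟨w, hw'⟩ : L n)) (hΨ.apply_of_mem_LU ha))
  exact Submodule.mem_sup.2 ⟨a, ha, _, hΨw, h.symm⟩

theorem IsPsi.LU_le (hΨ : IsPsi n r Ψ) :
    (LU n r).toSubmodule ≤
      (LY n r).toSubmodule ⊔ ((LU n (r + 1)).toSubmodule ⊔ (LPsiW r Ψ).toSubmodule) :=
  LU_le_LY_sup_LWreath.trans (sup_le_sup_left hΨ.LWreath_le _)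

/-- `L(Ψ(W))` lies in every ideal which contains the relators `ψ([u, z])`. -/
theorem IsPsi.LPsiW_le_ideal (hΨ : IsPsi n r Ψ) {I : LieIdeal ℤ (L n)}
    (hI : ∀ (a b : Gen n) (h : b.row < a.row), b.row = r → psi2 a b h ∈ I) :
    (LPsiW r Ψ).toSubmodule ≤ I.toSubmodule := by
  have h : LPsiW r Ψ ≤ I.toLieSubalgebra := by
    refine LieSubalgebra.lieSpan_le.2 ?_
    rintro _ ⟨w, hw, rfl⟩
    refine hΨ.apply_mem_of_mem_W (N := I.toSubmodule) (fun u z l => ?_) (fun u x hx => ?_) hw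
    · have := hI u.1 z.1 (z.2.trans_lt u.2) z.2
      generalize psi2 u.1 z.1 _ = x at *
      induction l generalizing x with
      | nil => exact this
      | cons z l ih => exact ih _ (lie_mem_left ℤ (L n) I _ _ this)
    · exact lie_mem_left ℤ (L n) I _ _ hx
  exact h

end PsiW

/-! ### Homogeneous components -/

section Grading

theorem homogeneous_mono {𝔤 : Type*} [LieRing 𝔤] {S T : Set 𝔤} (h : S ⊆ T) (m : ℕ) :
    homogeneous S m ≤ homogeneous T m := by
  refine Submodule.span_mono fun x hx => ?_
  induction hx with
  | of_mem hx => exact .of_mem (h hx)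
  | lie _ _ h1 h2 => exact .lie h1 h2

theorem lie_mem_homogeneous {𝔤 : Type*} [LieRing 𝔤] {S : Set 𝔤} {p q : ℕ} {a b : 𝔤}
    (ha : a ∈ homogeneous S p) (hb : b ∈ homogeneous S q) : ⁅a, b⁆ ∈ homogeneous S (p + q) := by
  have : lieProd (homogeneous S p) (homogeneous S q) ≤ homogeneous S (p + q) :=
    lieProd_span_le fun x hx z hz => Submodule.subset_span (.lie hx hz)
  exact this (Submodule.subset_span ⟨a, ha, b, hb, rfl⟩)

theorem lie_mem_iSup {𝔤 ι κ μ : Type*} [LieRing 𝔤] {A : ι → Submodule ℤ 𝔤}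
    {B : κ → Submodule ℤ 𝔤} {C : μ → Submodule ℤ 𝔤}
    (h : ∀ i j, ∃ k, ∀ a ∈ A i, ∀ b ∈ B j, ⁅a, b⁆ ∈ C k) {a b : 𝔤}
    (ha : a ∈ ⨆ i, A i) (hb : b ∈ ⨆ j, B j) : ⁅a, b⁆ ∈ ⨆ k, C k := by
  induction ha using Submodule.iSup_induction' with
  | mem i a ha =>
    induction hb using Submodule.iSup_induction' with
    | mem j b hb =>
      obtain ⟨k, hk⟩ := h i j
      exact Submodule.mem_iSup_of_mem k (hk a ha b hb)
    | zero => simp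
    | add x y _ _ h1 h2 => rw [lie_add]; exact add_mem h1 h2
  | zero => simp
  | add x y _ _ h1 h2 => rw [add_lie]; exact add_mem h1 h2

theorem lieSpan_le_iSup {𝔤 ι : Type*} [LieRing 𝔤] {S : Set 𝔤} {A : ι → Submodule ℤ 𝔤}
    (h : ∀ i j, ∃ k, ∀ a ∈ A i, ∀ b ∈ A j, ⁅a, b⁆ ∈ A k) (hS : ∀ s ∈ S, s ∈ ⨆ i, A i) :
    (LieSubalgebra.lieSpan ℤ 𝔤 S).toSubmodule ≤ ⨆ i, A i := by
  intro x hx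
  change x ∈ LieSubalgebra.lieSpan ℤ 𝔤 S at hx
  induction hx using LieSubalgebra.lieSpan_induction with
  | mem x hx => exact hS x hx
  | zero => exact zero_mem _
  | add x y _ _ h1 h2 => exact add_mem h1 h2
  | smul k x _ h => exact Submodule.smul_mem _ k h
  | lie x y _ _ h1 h2 => exact lie_mem_iSup h h1 h2

variable {n : ℕ}

open scoped TensorProduct in
variable (n) in
/-- The homomorphism `L → ℤ[X] ⊗ L` which multiplies the elements of degree `m` by `X ^ m`. -/
noncomputable def degreeHom : L n →ₗ⁅ℤ⁆ Polynomial ℤ ⊗[ℤ] L n :=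
  freeLift fun a => Polynomial.X ⊗ₜ y a

variable (n) in
/-- The projection of `L` onto its homogeneous component of degree `m`. -/
noncomputable def degreeProj (m : ℕ) : L n →ₗ[ℤ] L n :=
  (TensorProduct.lid ℤ (L n)).toLinearMap ∘ₗ
    (Polynomial.lcoeff ℤ m).rTensor (L n) ∘ₗ (degreeHom n).toLinearMap

open scoped TensorProduct in
theorem degreeHom_of_isLieMonomial {m : ℕ} {x : L n}
    (hx : IsLieMonomial (Set.range (y (n := n))) m x) :
    degreeHom n x = (Polynomial.X ^ m : Polynomial ℤ) ⊗ₜ[ℤ] x := by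
  induction hx with
  | of_mem h =>
    obtain ⟨a, rfl⟩ := h
    rw [degreeHom, pow_one, y, freeLift_of]; rfl
  | lie _ _ h1 h2 =>
    rw [LieHom.map_lie, h1, h2, LieAlgebra.ExtendScalars.bracket_tmul, pow_add]

theorem degreeProj_of_mem {m k : ℕ} {x : L n} (hx : x ∈ Ldeg n k) :
    degreeProj n m x = if m = k then x else 0 := by
  induction hx using Submodule.span_induction with
  | mem x hx =>
    have : degreeProj n m x = TensorProduct.lid ℤ (L n)
        ((Polynomial.lcoeff ℤ m).rTensor (L n) (degreeHom n x)) := rfl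
    rw [this, degreeHom_of_isLieMonomial hx, LinearMap.rTensor_tmul, Polynomial.lcoeff_apply,
      Polynomial.coeff_X_pow, TensorProduct.lid_tmul]
    split_ifs <;> simp
  | zero => simp
  | add x y _ _ h1 h2 => rw [map_add, h1, h2]; split_ifs <;> simp
  | smul c x _ h => rw [map_zsmul, h]; split_ifs <;> simp

/-- The projection onto degree `m` maps a graded submodule to its component of degree `m`. -/
theorem map_degreeProj_iSup_le {ι : Type*} {d : ι → ℕ} {A : ι → Submodule ℤ (L n)}
    (hA : ∀ i, A i ≤ Ldeg n (d i)) {m : ℕ} {N : Submodule ℤ (L n)}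
    (hN : ∀ i, d i = m → A i ≤ N) : (⨆ i, A i).map (degreeProj n m) ≤ N := by
  rw [Submodule.map_iSup]
  refine iSup_le fun i => ?_
  rintro _ ⟨x, hx, rfl⟩
  rw [degreeProj_of_mem (hA i hx)]
  split_ifs with h
  · exact hN i h.symm hx
  · exact N.zero_mem

theorem LYdeg_le_Ldeg (i m : ℕ) : LYdeg n i m ≤ Ldeg n m :=
  homogeneous_mono (by rintro _ ⟨a, -, rfl⟩; exact ⟨a, rfl⟩) m

theorem LYdeg_le_LY (i m : ℕ) : LYdeg n i m ≤ (LY n i).toSubmodule := by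
  refine Submodule.span_le.2 fun x hx => ?_
  induction hx with
  | of_mem h => exact LieSubalgebra.subset_lieSpan h
  | lie _ _ h1 h2 => exact LieSubalgebra.lie_mem _ h1 h2

theorem LY_le_iSup_LYdeg (i : ℕ) : (LY n i).toSubmodule ≤ ⨆ m, LYdeg n i m :=
  lieSpan_le_iSup (fun p q => ⟨p + q, fun _ ha _ hb => lie_mem_homogeneous ha hb⟩)
    fun _ hs => Submodule.mem_iSup_of_mem 1 (Submodule.subset_span (.of_mem hs))

theorem y_mem_Ldeg (a : Gen n) : y a ∈ Ldeg n 1 :=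
  Submodule.subset_span (.of_mem ⟨a, rfl⟩)

theorem psi2_mem_Ldeg (a b : Gen n) (h : b.row < a.row) : psi2 a b h ∈ Ldeg n 2 := by
  have h₁ : ∀ c d : Gen n, ⁅y c, y d⁆ ∈ Ldeg n (1 + 1) := fun c d =>
    lie_mem_homogeneous (y_mem_Ldeg c) (y_mem_Ldeg d)
  rw [psi2]
  split_ifs
  · exact sub_mem (h₁ _ _) (h₁ _ _)
  · exact h₁ _ _

variable {r : ℕ} {Ψ : LWreath n r ≃ₗ⁅ℤ⁆ LWreath n r}

theorem IsPsi.leftNormed_psi2_mem_LPsiW (hΨ : IsPsi n r Ψ) (u : Up n r) (z : Row n r)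
    (l : List (Row n r)) :
    leftNormed (psi2 u.1 z.1 (z.2.trans_lt u.2)) (l.map fun z => y z.1) ∈ LPsiW r Ψ := by
  have := hΨ.2 u.1 z.1 u.2 z.2 (l.map Subtype.val)
    (by intro w hw; obtain ⟨v, -, rfl⟩ := List.mem_map.1 hw; exact v.2)
  simp only [List.map_map] at this
  exact LieSubalgebra.subset_lieSpan
    ⟨⟨_, leftNormed_lie_mem_LWreath u z l⟩, leftNormed_mem_W u z l, this⟩

theorem IsPsi.lie_mem_LPsiW (hΨ : IsPsi n r Ψ) (u : Up n r) {x : L n} (hx : x ∈ LPsiW r Ψ) :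
    ⁅x, y u.1⁆ ∈ LPsiW r Ψ := by
  refine lieSpan_lie_mem ?_ hx
  rintro _ ⟨w, hw, rfl⟩
  have : (Ψ ⁅w, (⟨y u.1, y_mem_LWreath u⟩ : LWreath n r)⁆ : L n) = ⁅(Ψ w : L n), y u.1⁆ :=
    (congrArg Subtype.val (LieEquiv.map_lie Ψ w ⟨y u.1, y_mem_LWreath u⟩)).trans
      (congrArg (fun b => ⁅(Ψ w : L n), b⁆) (hΨ.1 u.1 u.2))
  exact LieSubalgebra.subset_lieSpan ⟨_, lie_mem_W u hw, this⟩

theorem leftNormed_mem_Ldeg {k : ℕ} {x : L n} (hx : x ∈ Ldeg n k) (l : List (Row n r)) :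
    leftNormed x (l.map fun z => y z.1) ∈ Ldeg n (k + l.length) := by
  induction l generalizing k x with
  | nil => exact hx
  | cons z l ih =>
    rw [List.length_cons, ← add_assoc, add_right_comm]
    exact ih (lie_mem_homogeneous hx (y_mem_Ldeg z.1))

/-- `L(Ψ(W))` is a graded submodule, with components in degrees at least `2`. -/
theorem IsPsi.LPsiW_le_iSup_Lgrad (hΨ : IsPsi n r Ψ) :
    (LPsiW r Ψ).toSubmodule ≤ ⨆ m : Set.Ici 2, Lgrad r Ψ m := by
  refine lieSpan_le_iSup ?_ ?_
  · rintro ⟨p, hp⟩ ⟨q, hq⟩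
    exact ⟨⟨p + q, le_add_right (show 2 ≤ p from hp)⟩, fun a ha b hb =>
      ⟨lie_mem_homogeneous ha.1 hb.1, LieSubalgebra.lie_mem _ ha.2 hb.2⟩⟩
  · rintro _ ⟨w, hw, rfl⟩
    refine hΨ.apply_mem_of_mem_W (fun u z l => ?_) (fun u x hx => ?_) hw
    · exact Submodule.mem_iSup_of_mem (⟨2 + l.length, Nat.le_add_right 2 _⟩ : Set.Ici 2)
        ⟨leftNormed_mem_Ldeg (psi2_mem_Ldeg _ _ _) l, hΨ.leftNormed_psi2_mem_LPsiW u z l⟩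
    · induction hx using Submodule.iSup_induction' with
      | mem m x hx =>
        exact Submodule.mem_iSup_of_mem
          (⟨m + 1, le_add_right (show 2 ≤ (m : ℕ) from m.2)⟩ : Set.Ici 2)
          ⟨lie_mem_homogeneous hx.1 (y_mem_Ldeg u.1), hΨ.lie_mem_LPsiW u hx.2⟩
      | zero => simp
      | add a b _ _ h1 h2 => rw [add_lie]; exact add_mem h1 h2

end Grading

/-! ### The decompositions -/

section Decomposition

variable {n : ℕ}

theorem rowProj_of_mem_ideal {r t : ℕ} {I : LieIdeal ℤ (L n)}
    (hI : I ≤ (rowAction n r t).ker) {x : L n} (hx : x ∈ I) : rowProj n r t x = 0 := by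
  rw [rowProj_eq, LieHom.mem_ker.1 (hI hx)]; rfl

/-- If all rows above `r + 1` are killed, then every relator is: its second row is at most `r`, or
its first row is above `r + 1`. -/
theorem rowProj_of_mem_J (r : ℕ) {x : L n} (hx : x ∈ J n) : rowProj n r (r + 1) x = 0 := by
  refine rowProj_of_mem_ideal (LieSubmodule.lieSpan_le.2 ?_) hx
  rw [relators_eq]
  rintro _ ⟨a, b, h, rfl⟩
  exact LieHom.mem_ker.2 (rowAction_psi2 h (by omega))

theorem rowProj_of_mem_LY_low {r t i : ℕ} (h : i ≤ r) {x : L n} (hx : x ∈ LY n i) :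
    rowProj n r t x = 0 := by
  refine rowAction_low ?_ hx
  rintro _ ⟨a, rfl, rfl⟩
  exact ⟨a, h, rfl⟩

theorem rowProj_of_mem_LY_mid {r t i : ℕ} (h : r < i) (h' : i ≤ t) {x : L n}
    (hx : x ∈ LY n i) : rowProj n r t x = x := by
  rw [rowProj_eq, rowAction_mid _ hx]; · rfl
  rintro _ ⟨a, rfl, rfl⟩
  exact ⟨a, ⟨h, h'⟩, rfl⟩

theorem rowProj_of_mem_LY_high {r t i : ℕ} (h : r < i) (h' : t < i) {x : L n}
    (hx : x ∈ LY n i) : rowProj n r t x = 0 := by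
  rw [rowProj_eq, rowAction_high _ hx]; · rfl
  rintro _ ⟨a, rfl, rfl⟩
  exact ⟨a, ⟨h, h'⟩, rfl⟩

theorem rowProj_pred_self {i : ℕ} (hi : 2 ≤ i) {x : L n} (hx : x ∈ LY n i) :
    rowProj n (i - 1) (i - 1 + 1) x = x :=
  rowProj_of_mem_LY_mid (by omega) (by omega) hx

theorem rowProj_pred_of_ne {i j : ℕ} (hi : 2 ≤ i) (hij : i ≠ j) {x : L n} (hx : x ∈ LY n j) :
    rowProj n (i - 1) (i - 1 + 1) x = 0 := by
  rcases hij.lt_or_gt with h | h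
  · exact rowProj_of_mem_LY_high (by omega) (by omega) hx
  · exact rowProj_of_mem_LY_low (by omega) hx

theorem rowProj_of_mem_LU {r s : ℕ} (h : r < s) {x : L n} (hx : x ∈ LU n s) :
    rowProj n r n x = x := by
  rw [rowProj_eq, rowAction_mid _ hx]; · rfl
  rintro _ ⟨a, ha, rfl⟩
  exact ⟨a, ⟨h.trans_le ha, a.row_le⟩, rfl⟩

variable (n) in
/-- The projection of `L` onto `J` along the subalgebras `L(Y_i)`. -/
noncomputable def idealProj : L n →ₗ[ℤ] L n :=
  LinearMap.id - ∑ m ∈ Finset.Icc 1 (n - 1), rowProj n m (m + 1)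

theorem idealProj_of_mem_J {x : L n} (hx : x ∈ J n) : idealProj n x = x := by
  rw [idealProj, LinearMap.sub_apply, LinearMap.sum_apply,
    Finset.sum_eq_zero fun m _ => rowProj_of_mem_J m hx, sub_zero]; rfl

theorem idealProj_of_mem_LY {i : ℕ} (hi : i ∈ Set.Icc 2 n) {x : L n} (hx : x ∈ LY n i) :
    idealProj n x = 0 := by
  obtain ⟨h2, hn⟩ := hi
  rw [idealProj, LinearMap.sub_apply, LinearMap.sum_apply, Finset.sum_eq_single (i - 1),
    rowProj_of_mem_LY_mid (by omega) (by omega) hx]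
  · exact sub_self x
  · intro m _ hm
    rcases lt_or_ge m i with h | h
    · exact rowProj_of_mem_LY_high h (by omega) hx
    · exact rowProj_of_mem_LY_low h hx
  · intro h
    exact absurd (Finset.mem_Icc.2 ⟨by omega, by omega⟩) h

variable {Ψ : (r : ℕ) → LWreath n r ≃ₗ⁅ℤ⁆ LWreath n r}

theorem IsPsi.LPsiW_le_J {r : ℕ} {Ψ : LWreath n r ≃ₗ⁅ℤ⁆ LWreath n r} (hΨ : IsPsi n r Ψ) :
    (LPsiW r Ψ).toSubmodule ≤ (J n).toSubmodule := by
  refine hΨ.LPsiW_le_ideal fun a b h _ => LieSubmodule.subset_lieSpan ?_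
  rw [relators_eq]
  exact ⟨a, b, h, rfl⟩

theorem IsPsi.rowProj_of_mem_LPsiW {s r : ℕ} {Ψ : LWreath n s ≃ₗ⁅ℤ⁆ LWreath n s}
    (hΨ : IsPsi n s Ψ) (h : s ≤ r) {x : L n} (hx : x ∈ LPsiW s Ψ) : rowProj n r n x = 0 := by
  refine rowProj_of_mem_ideal le_rfl
    (hΨ.LPsiW_le_ideal (I := (rowAction n r n).ker) ?_ hx)
  intro a b hab hb
  exact LieHom.mem_ker.2 (rowAction_psi2 hab (Or.inl (hb.trans_le h)))

/-- Descent on the lowest row `r = n - k`. -/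
theorem LU_le_iSup (hΨ : ∀ r ∈ Set.Ico 2 n, IsPsi n r (Ψ r)) (k r : ℕ) (hr : 2 ≤ r)
    (hk : r + k = n) :
    (LU n r).toSubmodule ≤ (⨆ i : Set.Icc 2 n, (LY n i).toSubmodule) ⊔
      ⨆ j : Set.Ico 2 n, (LPsiW (j : ℕ) (Ψ j)).toSubmodule := by
  have hY : (LY n r).toSubmodule ≤ ⨆ i : Set.Icc 2 n, (LY n i).toSubmodule :=
    le_iSup (fun i : Set.Icc 2 n => (LY n i).toSubmodule) ⟨r, hr, by omega⟩
  induction k generalizing r with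
  | zero =>
    obtain rfl : r = n := hk
    have : LU r r ≤ LY r r := by
      refine LieSubalgebra.lieSpan_mono ?_
      rintro _ ⟨a, ha, rfl⟩
      exact ⟨a, le_antisymm a.row_le ha, rfl⟩
    exact le_trans this (le_sup_of_le_left hY)
  | succ k ih =>
    have hrn : r ∈ Set.Ico 2 n := ⟨hr, by omega⟩
    refine (hΨ r hrn).LU_le.trans
      (sup_le (le_sup_of_le_left hY) (sup_le (ih (r + 1) (by omega) (by omega) ?_)
        (le_sup_of_le_right ?_)))
    · exact le_iSup (fun i : Set.Icc 2 n => (LY n i).toSubmodule)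
        ⟨r + 1, by omega, by omega⟩
    · exact le_iSup (fun j : Set.Ico 2 n => (LPsiW (j : ℕ) (Ψ j)).toSubmodule) ⟨r, hrn⟩

theorem iSup_LY_sup_iSup_LPsiW (hn : 2 ≤ n) (hΨ : ∀ r ∈ Set.Ico 2 n, IsPsi n r (Ψ r)) :
    (⨆ i : Set.Icc 2 n, (LY n i).toSubmodule) ⊔
      ⨆ j : Set.Ico 2 n, (LPsiW (j : ℕ) (Ψ j)).toSubmodule = ⊤ := by
  have h : LU n 2 = ⊤ := by
    rw [eq_top_iff, ← lieSpan_range_of]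
    refine LieSubalgebra.lieSpan_mono ?_
    rintro _ ⟨a, rfl⟩
    exact ⟨a, a.two_le_row, rfl⟩
  rw [eq_top_iff]
  refine le_trans ?_ (LU_le_iSup hΨ (n - 2) 2 le_rfl (by omega))
  rw [h]
  exact le_rfl

/-- Apply `idealProj` to the decomposition of an element of `J`. -/
theorem J_le_iSup_LPsiW (hn : 2 ≤ n) (hΨ : ∀ r ∈ Set.Ico 2 n, IsPsi n r (Ψ r)) :
    (J n).toSubmodule ≤ ⨆ j : Set.Ico 2 n, (LPsiW (j : ℕ) (Ψ j)).toSubmodule := by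
  intro x hx
  have hx' : x ∈ (⨆ i : Set.Icc 2 n, (LY n i).toSubmodule) ⊔
      ⨆ j : Set.Ico 2 n, (LPsiW (j : ℕ) (Ψ j)).toSubmodule := by
    rw [iSup_LY_sup_iSup_LPsiW hn hΨ]; trivial
  obtain ⟨a, ha, b, hb, rfl⟩ := Submodule.mem_sup.1 hx'
  have ha' : idealProj n a = 0 := by
    have : ⨆ i : Set.Icc 2 n, (LY n i).toSubmodule ≤ LinearMap.ker (idealProj n) :=
      iSup_le fun i x hx => idealProj_of_mem_LY i.2 hx
    exact this ha
  have hb' : b ∈ J n :=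
    (iSup_le fun j : Set.Ico 2 n => (hΨ j j.2).LPsiW_le_J :
      ⨆ j : Set.Ico 2 n, (LPsiW (j : ℕ) (Ψ j)).toSubmodule ≤ (J n).toSubmodule) hb
  have h := idealProj_of_mem_J hx
  rw [map_add, ha', zero_add, idealProj_of_mem_J hb'] at h
  rwa [← h]

theorem isDirectSum_LY_J (hn : 2 ≤ n) :
    IsDirectSum (Sum.elim (fun i : Set.Icc 2 n => (LY n i).toSubmodule)
      (fun _ : Unit => (J n).toSubmodule)) ⊤ := by
  constructor
  · refine iSupIndep_of_maps _
      (Sum.elim (fun i : Set.Icc 2 n => rowProj n (i - 1) (i - 1 + 1)) fun _ => idealProj n) ?_ ?_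
    · rintro (⟨i, hi⟩ | _) x hx h
      · exact (rowProj_pred_self hi.1 hx).symm.trans h
      · exact (idealProj_of_mem_J hx).symm.trans h
    · rintro (⟨i, hi⟩ | _) (⟨j, hj⟩ | _) hij x hx
      · exact rowProj_pred_of_ne hi.1 (fun h => hij (by subst h; rfl)) hx
      · exact rowProj_of_mem_J _ hx
      · exact idealProj_of_mem_LY hj hx
      · exact absurd rfl hij
  · have hΨ : ∀ r ∈ Set.Ico 2 n, IsPsi n r (psiEquiv n r) := fun _ _ => psiEquiv_isPsi
    rw [eq_top_iff, iSup_sum, ← iSup_LY_sup_iSup_LPsiW hn hΨ]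
    refine sup_le_sup le_rfl (le_iSup_of_le () (iSup_le fun j => psiEquiv_isPsi.LPsiW_le_J))

theorem isDirectSum_Jdeg (hn : 2 ≤ n) :
    IsDirectSum (fun m : Set.Ici 2 => Jdeg n m) (J n).toSubmodule := by
  constructor
  · refine iSupIndep_of_maps _ (fun m => degreeProj n m) ?_ ?_
    · intro m x hx h
      rwa [degreeProj_of_mem hx.2, if_pos rfl] at h
    · intro m k hmk x hx
      rw [degreeProj_of_mem hx.2, if_neg fun h => hmk (Subtype.ext h)]
  · refine le_antisymm (iSup_le fun m => inf_le_left) ?_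
    refine (J_le_iSup_LPsiW hn (Ψ := psiEquiv n) fun _ _ => psiEquiv_isPsi).trans ?_
    refine iSup_le fun j => psiEquiv_isPsi.LPsiW_le_iSup_Lgrad.trans (iSup_mono fun m x hx => ?_)
    exact ⟨psiEquiv_isPsi.LPsiW_le_J hx.2, hx.1⟩

theorem map_degreeProj_LY_le (i m : ℕ) :
    (LY n i).toSubmodule.map (degreeProj n m) ≤ LYdeg n i m :=
  (Submodule.map_mono (LY_le_iSup_LYdeg i)).trans
    (map_degreeProj_iSup_le (d := id) (LYdeg_le_Ldeg i) fun _ h => h ▸ le_rfl)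

theorem IsPsi.map_degreeProj_LPsiW_le {r : ℕ} {Ψ : LWreath n r ≃ₗ⁅ℤ⁆ LWreath n r}
    (hΨ : IsPsi n r Ψ) (m : ℕ) :
    (LPsiW r Ψ).toSubmodule.map (degreeProj n m) ≤ Lgrad r Ψ m := by
  refine (Submodule.map_mono hΨ.LPsiW_le_iSup_Lgrad).trans
    (map_degreeProj_iSup_le (d := Subtype.val) (fun _ => inf_le_left) ?_)
  rintro k rfl
  exact le_rfl

theorem map_degreeProj_iSup_LPsiW_le (hΨ : ∀ r ∈ Set.Ico 2 n, IsPsi n r (Ψ r)) (m : ℕ) :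
    (⨆ j : Set.Ico 2 n, (LPsiW (j : ℕ) (Ψ j)).toSubmodule).map (degreeProj n m) ≤
      ⨆ j : Set.Ico 2 n, Lgrad (j : ℕ) (Ψ j) m := by
  rw [Submodule.map_iSup]
  exact iSup_mono fun j : Set.Ico 2 n => (hΨ j j.2).map_degreeProj_LPsiW_le m

theorem mem_map_degreeProj {m : ℕ} {N : Submodule ℤ (L n)} {x : L n} (hx : x ∈ Ldeg n m)
    (hN : x ∈ N) : x ∈ N.map (degreeProj n m) :=
  ⟨x, hN, by rw [degreeProj_of_mem hx, if_pos rfl]⟩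

theorem Ldeg_le_iSup_LYdeg_sup_iSup_Lgrad (hn : 2 ≤ n)
    (hΨ : ∀ r ∈ Set.Ico 2 n, IsPsi n r (Ψ r)) (m : ℕ) :
    Ldeg n m ≤ (⨆ i : Set.Icc 2 n, LYdeg n i m) ⊔
      ⨆ j : Set.Ico 2 n, Lgrad (j : ℕ) (Ψ j) m := by
  intro x hx
  have h := mem_map_degreeProj (N := ⊤) hx trivial
  rw [← iSup_LY_sup_iSup_LPsiW hn hΨ, Submodule.map_sup] at h
  have hY : (⨆ i : Set.Icc 2 n, (LY n i).toSubmodule).map (degreeProj n m) ≤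
      ⨆ i : Set.Icc 2 n, LYdeg n i m := by
    rw [Submodule.map_iSup]
    exact iSup_mono fun i : Set.Icc 2 n => map_degreeProj_LY_le i m
  exact sup_le_sup hY (map_degreeProj_iSup_LPsiW_le hΨ m) h

theorem isDirectSum_LYdeg_Lgrad (hn : 2 ≤ n) (hΨ : ∀ r ∈ Set.Ico 2 n, IsPsi n r (Ψ r)) (m : ℕ) :
    IsDirectSum (Sum.elim (fun i : Set.Icc 2 n => LYdeg n i m)
      (fun j : Set.Ico 2 n => Lgrad (j : ℕ) (Ψ j) m)) (Ldeg n m) := by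
  constructor
  · -- on `J`, the difference of two consecutive projections `rowProj` singles out one `LPsiW`
    refine iSupIndep_of_maps _
      (Sum.elim (fun i : Set.Icc 2 n => rowProj n (i - 1) (i - 1 + 1)) fun j : Set.Ico 2 n =>
        (rowProj n (j - 1) n - rowProj n j n) ∘ₗ idealProj n) ?_ ?_
    · rintro (⟨i, hi⟩ | ⟨j, hj⟩) x hx h
      · exact (rowProj_pred_self hi.1 (LYdeg_le_LY i m hx)).symm.trans h
      · change rowProj n (j - 1) n (idealProj n x) - rowProj n j n (idealProj n x) = 0 at h
        rwa [idealProj_of_mem_J ((hΨ j hj).LPsiW_le_J hx.2),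
          (hΨ j hj).rowProj_of_mem_LPsiW le_rfl hx.2,
          rowProj_of_mem_LU (s := j) (by have := hj.1; omega)
            (LWreath_le_LU (LPsiW_le_LWreath hx.2)), sub_zero] at h
    · rintro (⟨i, hi⟩ | ⟨i, hi⟩) (⟨j, hj⟩ | ⟨j, hj⟩) hij x hx
      · exact rowProj_pred_of_ne hi.1 (fun h => hij (by subst h; rfl)) (LYdeg_le_LY j m hx)
      · exact rowProj_of_mem_J _ ((hΨ j hj).LPsiW_le_J hx.2)
      · change rowProj n (i - 1) n (idealProj n x) - rowProj n i n (idealProj n x) = 0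
        rw [idealProj_of_mem_LY hj (LYdeg_le_LY j m hx), map_zero, map_zero, sub_zero]
      · have hij' : i ≠ j := fun h => hij (by subst h; rfl)
        change rowProj n (i - 1) n (idealProj n x) - rowProj n i n (idealProj n x) = 0
        have hU := LWreath_le_LU (LPsiW_le_LWreath hx.2)
        rw [idealProj_of_mem_J ((hΨ j hj).LPsiW_le_J hx.2)]
        rcases hij'.lt_or_gt with h | h
        · rw [rowProj_of_mem_LU (s := j) (by omega) hU, rowProj_of_mem_LU (s := j) h hU, sub_self]
        · rw [(hΨ j hj).rowProj_of_mem_LPsiW (by omega) hx.2,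
            (hΨ j hj).rowProj_of_mem_LPsiW h.le hx.2, sub_zero]
  · rw [iSup_sum]
    refine le_antisymm (sup_le (iSup_le fun i => LYdeg_le_Ldeg _ m) (iSup_le fun j => inf_le_left))
      (Ldeg_le_iSup_LYdeg_sup_iSup_Lgrad hn hΨ m)

theorem isDirectSum_Lgrad (hn : 2 ≤ n) (hΨ : ∀ r ∈ Set.Ico 2 n, IsPsi n r (Ψ r)) (m : ℕ) :
    IsDirectSum (fun j : Set.Ico 2 n => Lgrad (j : ℕ) (Ψ j) m) (Jdeg n m) := by
  refine ⟨(isDirectSum_LYdeg_Lgrad hn hΨ m).1.comp Sum.inr_injective, le_antisymm ?_ ?_⟩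
  · exact iSup_le fun j x hx => ⟨(hΨ j j.2).LPsiW_le_J hx.2, hx.1⟩
  · rintro x ⟨hxJ, hx⟩
    exact map_degreeProj_iSup_LPsiW_le hΨ m
      (mem_map_degreeProj hx (J_le_iSup_LPsiW hn hΨ hxJ))

end Decomposition

end PartialInner

theorem mainTheorem3 (n : ℕ) (hn : 3 ≤ n) :
    -- `L = (⨁_{i=2}^n L(Y_i)) ⊕ J`
    PartialInner.IsDirectSum
      (Sum.elim (fun i : Set.Icc 2 n => (PartialInner.LY n i).toSubmodule)
        (fun _ : Unit => (PartialInner.J n).toSubmodule)) ⊤ ∧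
    -- `J = ⨁_{m ≥ 2} J^m`
    PartialInner.IsDirectSum (fun m : Set.Ici 2 => PartialInner.Jdeg n m)
      (PartialInner.J n).toSubmodule ∧
    -- each `Ψ_r` exists and is unique
    (∀ r ∈ Set.Ico 2 n, ∃! Ψ : PartialInner.LWreath n r ≃ₗ⁅ℤ⁆ PartialInner.LWreath n r,
      PartialInner.IsPsi n r Ψ) ∧
    ∀ Ψ : (r : ℕ) → PartialInner.LWreath n r ≃ₗ⁅ℤ⁆ PartialInner.LWreath n r,
      (∀ r ∈ Set.Ico 2 n, PartialInner.IsPsi n r (Ψ r)) →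
      ∀ m : ℕ, 2 ≤ m →
        -- `L^m = (⨁_{i=2}^n L^m(Y_i)) ⊕ (⨁_{j=2}^{n-1} L^m_grad(Ψ_j(W_(j))))`
        PartialInner.IsDirectSum
          (Sum.elim (fun i : Set.Icc 2 n => PartialInner.LYdeg n i m)
            (fun j : Set.Ico 2 n => PartialInner.Lgrad (j : ℕ) (Ψ j) m))
          (PartialInner.Ldeg n m) ∧
        -- `J^m = ⨁_{j=2}^{n-1} L^m_grad(Ψ_j(W_(j)))`
        PartialInner.IsDirectSum
          (fun j : Set.Ico 2 n => PartialInner.Lgrad (j : ℕ) (Ψ j) m)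
          (PartialInner.Jdeg n m) := by
  have hn : 2 ≤ n := by omega
  exact ⟨PartialInner.isDirectSum_LY_J hn, PartialInner.isDirectSum_Jdeg hn,
    fun r _ => ⟨PartialInner.psiEquiv n r, PartialInner.psiEquiv_isPsi,
      fun _ hΦ => hΦ.eq PartialInner.psiEquiv_isPsi⟩,
    fun Ψ hΨ m _ => ⟨PartialInner.isDirectSum_LYdeg_Lgrad hn hΨ m,
      PartialInner.isDirectSum_Lgrad hn hΨ m⟩⟩
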